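/- Let $n\ge 1$. Let $\mathrm{OPol}_n=\mathbb{Z}\langle x_1,\dots,x_n\rangle/(x_ix_j+x_jx_i : i\neq j)$ be the ring of skew polynomials and put $\tilde x_i=(-1)^{i-1}x_i$. For $1\le i\le n-1$ let $s_i$ be the ring endomorphism of $\mathrm{OPol}_n$ with $s_i(x_i)=-x_{i+1}$, $s_i(x_{i+1})=-x_i$ and $s_i(x_j)=-x_j$ for $j\ne i,i+1$, and let $\partial_i$ be the $\mathbb{Z}$-linear operator on $\mathrm{OPol}_n$ determined by $\partial_i(x_i)=\partial_i(x_{i+1})=1$, $\partial_i(x_j)=0$ for $j\neq i,i+1$, and $\partial_i(fg)=\partial_i(f)g+s_i(f)\partial_i(g)$. Let $\mathrm{O}\Lambda_n=\bigcap_{i=1}^{n-1}\ker\partial_i\subset\mathrm{OPol}_n$ be the ring of odd symmetric polynomials. Let $\mathbb{Z}Pl_n$ be the odd plactic ring: the unital ring generated by the letters $1,\dots,n$ subject to the relations $yzx=-yxz$ for $x<y\le z$ and $xzy=-zxy$ for $x\le y<z$. There is a well-defined ring homomorphism $\mathbb{Z}Pl_n\to\mathrm{OPol}_n$, written $w\mapsto\tilde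 x^{w}$, which sends each letter $i$ to $\tilde x_i$. For a partition $\lambda$, set $$\widehat s_\lambda=(-1)^{dN(\lambda)+N(\lambda)}\sum_{T}w_r(T)\in\mathbb{Z}Pl_n ,$$ where $T$ runs over the semistandard Young tableaux of shape $\lambda$ with entries in $\{1,\dots,n\}$ (rows weakly increasing from left to right, columns strictly increasing from top to bottom), $w_r(T)$ is the row word of $T$ (entries read from left to right in each row, rows taken from bottom to top), $N(\lambda)$ is the number of pairs $(B,C)$ of boxes of $\lambda$ such that $C$ lies in a row strictly above that of $B$, and $dN(\lambda)$ is the number of such pairs in which moreover $C$ and $B$ lie in the same column. Then the $\mathbb{Z}$-span of the elements $\widehat s_\lambda$, with $\lambda$ running over all partitions, is a (unital) subalgebra of $\mathbb{Z}Pl_n$ isomorphic to $\mathrm{O}\Lambda_n$; moreover, the map $w\mapsto\tilde x^{w}$ restricts to an algebra isomorphism from this subalgebra onto $\mathrm{O}\Lambda_n\subset\mathrm{OPol}_n$. -/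

import Mathlib

/-! Odd symmetric polynomials and the odd plactic ring on `n` letters.
The alphabet `{1, ..., n}` is modelled by `Fin n`, so the letter `i` of `{1, ..., n}` is
`i - 1 : Fin n`, and the sign `(-1)^(i-1)` becomes `(-1)^(i : ℕ)`. -/

/-! ### Skew polynomials -/

/-- The defining relations `x_i x_j + x_j x_i = 0` (`i ≠ j`) of the ring of skew polynomials. -/
inductive OPolRel (n : ℕ) : FreeAlgebra ℤ (Fin n) → FreeAlgebra ℤ (Fin n) → Prop
  | anticomm (i j : Fin n) (h : i ≠ j) :
      OPolRel n (FreeAlgebra.ι ℤ i * FreeAlgebra.ι ℤ j + FreeAlgebra.ι ℤ j * FreeAlgebra.ι ℤ i) 0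

/-- The ring of skew polynomials `ℤ⟨x_1, ..., x_n⟩ / (x_i x_j + x_j x_i, i ≠ j)`. -/
def OPol (n : ℕ) : Type := RingQuot (OPolRel n)

noncomputable instance OPol.instRing (n : ℕ) : Ring (OPol n) :=
  inferInstanceAs (Ring (RingQuot (OPolRel n)))

namespace OPol

/-- The quotient map from the free ring. -/
noncomputable def mk (n : ℕ) : FreeAlgebra ℤ (Fin n) →+* OPol n := RingQuot.mkRingHom (OPolRel n)

/-- The generator `x_i`. -/
noncomputable def x {n : ℕ} (i : Fin n) : OPol n := mk n (FreeAlgebra.ι ℤ i)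

theorem x_anticomm {n : ℕ} {i j : Fin n} (h : i ≠ j) : (x i * x j : OPol n) = -(x j * x i) := by
  have : mk n (FreeAlgebra.ι ℤ i * FreeAlgebra.ι ℤ j + FreeAlgebra.ι ℤ j * FreeAlgebra.ι ℤ i)
      = mk n 0 := RingQuot.mkRingHom_rel (OPolRel.anticomm i j h)
  rw [map_add, map_mul, map_mul, map_zero] at this
  exact eq_neg_of_add_eq_zero_left this

/-- The signed generator `x̃_i = (-1)^(i-1) x_i` (letters numbered from `1`). -/
noncomputable def xt {n : ℕ} (i : Fin n) : OPol n := (-1) ^ (i : ℕ) * x i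

theorem xt_anticomm {n : ℕ} {i j : Fin n} (h : i ≠ j) :
    (xt i * xt j : OPol n) = -(xt j * xt i) := by
  unfold xt
  rcases neg_one_pow_eq_or (OPol n) (i : ℕ) with hi | hi <;>
  rcases neg_one_pow_eq_or (OPol n) (j : ℕ) with hj | hj <;>
  simp [hi, hj, x_anticomm h]

/-- The value `s(x_j)` on generators of the signed action of the transposition `s` of `a` and `b`:
`x_a ↦ -x_b`, `x_b ↦ -x_a`, `x_j ↦ -x_j` for `j ≠ a, b`. -/
noncomputable def sGen {n : ℕ} (a b j : Fin n) : OPol n := -x (Equiv.swap a b j)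

/-- The value on generators of the odd divided difference operator: `x_a, x_b ↦ 1`, and
`x_j ↦ 0` for `j ≠ a, b`. -/
noncomputable def dGen {n : ℕ} (a b j : Fin n) : OPol n := if j = a ∨ j = b then 1 else 0

/-- The ring homomorphism `f ↦ !![s f, ∂ f; 0, f]`, where `s` is the action of the transposition
of `a` and `b` and `∂` the odd divided difference operator. Its multiplicativity is exactly the
multiplicativity of `s` together with the Leibniz rule `∂(f g) = ∂(f) g + s(f) ∂(g)`. -/
noncomputable def leibnizHom {n : ℕ} (a b : Fin n) :
    OPol n →+* Matrix (Fin 2) (Fin 2) (OPol n) :=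
  RingQuot.lift
    ⟨(FreeAlgebra.lift ℤ fun j =>
        (!![sGen a b j, dGen a b j; 0, x j] : Matrix (Fin 2) (Fin 2) (OPol n))).toRingHom, by
      rintro _ _ ⟨j, k, h⟩
      have h1 : sGen a b j * sGen a b k + sGen a b k * sGen a b j = 0 := by
        simp [sGen, x_anticomm ((Equiv.swap a b).injective.ne h)]
      have h2 : x j * x k + x k * x j = 0 := by simp [x_anticomm h]
      have h3 : sGen a b j * dGen a b k + dGen a b j * x k
          + (sGen a b k * dGen a b j + dGen a b k * x j) = 0 := by
        by_cases hja : j = a <;> by_cases hjb : j = b <;> by_cases hka : k = a <;>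
          by_cases hkb : k = b <;>
          simp_all [sGen, dGen, Equiv.swap_apply_of_ne_of_ne]
      simp only [AlgHom.toRingHom_eq_coe, RingHom.coe_coe, map_add, map_mul, map_zero,
        FreeAlgebra.lift_ι_apply]
      ext p q
      fin_cases p <;> fin_cases q <;> simp [h1, h2, h3]⟩

/-- The signed action of the transposition of `a` and `b`. -/
noncomputable def s {n : ℕ} (a b : Fin n) (f : OPol n) : OPol n := leibnizHom a b f 0 0

/-- The odd divided difference operator attached to the transposition of `a` and `b`;
the operator `∂_i` is `∂ i (i+1)`. -/
noncomputable def divDiff {n : ℕ} (a b : Fin n) (f : OPol n) : OPol n := leibnizHom a b f 0 1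

theorem leibnizHom_x {n : ℕ} (a b j : Fin n) :
    leibnizHom a b (x j) = !![sGen a b j, dGen a b j; 0, x j] := by
  unfold leibnizHom x mk
  erw [RingQuot.lift_mkRingHom_apply]
  simp

theorem leibnizHom_lower {n : ℕ} (a b : Fin n) (f : OPol n) :
    leibnizHom a b f 1 0 = 0 ∧ leibnizHom a b f 1 1 = f := by
  obtain ⟨p, rfl⟩ : ∃ p, mk n p = f := RingQuot.mkRingHom_surjective (OPolRel n) f
  induction p using FreeAlgebra.induction with
  | grade0 r => simp [Matrix.intCast_apply]
  | grade1 j => exact ⟨by simpa [x] using congrFun₂ (leibnizHom_x a b j) 1 0,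
      by simpa [x] using congrFun₂ (leibnizHom_x a b j) 1 1⟩
  | mul p q hp hq => simp [Matrix.mul_apply, Fin.sum_univ_two, hp, hq]
  | add p q hp hq => simp [hp, hq]

theorem s_x {n : ℕ} (a b j : Fin n) : s a b (x j) = -x (Equiv.swap a b j) := by
  simp [s, leibnizHom_x, sGen]

theorem s_mul {n : ℕ} (a b : Fin n) (f g : OPol n) : s a b (f * g) = s a b f * s a b g := by
  simp [s, Matrix.mul_apply, Fin.sum_univ_two, leibnizHom_lower]

theorem divDiff_x {n : ℕ} (a b j : Fin n) : divDiff a b (x j) = 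
    if j = a ∨ j = b then 1 else 0 := by
  simp [divDiff, leibnizHom_x, dGen]

/-- The Leibniz rule. -/
theorem divDiff_mul {n : ℕ} (a b : Fin n) (f g : OPol n) :
    divDiff a b (f * g) = divDiff a b f * g + s a b f * divDiff a b g := by
  simp [divDiff, s, Matrix.mul_apply, Fin.sum_univ_two, leibnizHom_lower, add_comm]

theorem divDiff_add {n : ℕ} (a b : Fin n) (f g : OPol n) :
    divDiff a b (f + g) = divDiff a b f + divDiff a b g := by
  simp [divDiff]

end OPol

/-- The ring `OΛ_n` of odd symmetric polynomials: the intersection of the kernels of the odd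
divided difference operators `∂_i` for `i = 1, ..., n - 1`. -/
noncomputable def OddSymm (n : ℕ) : Subalgebra ℤ (OPol n) where
  carrier := {f | ∀ a b : Fin n, (b : ℕ) = a + 1 → OPol.divDiff a b f = 0}
  mul_mem' hf hg a b h := by rw [OPol.divDiff_mul, hf a b h, hg a b h]; simp
  add_mem' hf hg a b h := by rw [OPol.divDiff_add, hf a b h, hg a b h]; simp
  algebraMap_mem' r a b _ := by simp [OPol.divDiff, Matrix.intCast_apply]

/-! ### The odd plactic ring -/

/-- The signed elementary Knuth relations. -/
inductive OddPlacticRel (n : ℕ) : FreeAlgebra ℤ (Fin n) → FreeAlgebra ℤ (Fin n) → Prop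
  | knuth₁ (x y z : Fin n) (hxy : x < y) (hyz : y ≤ z) :
      OddPlacticRel n (FreeAlgebra.ι ℤ y * FreeAlgebra.ι ℤ z * FreeAlgebra.ι ℤ x)
        (-(FreeAlgebra.ι ℤ y * FreeAlgebra.ι ℤ x * FreeAlgebra.ι ℤ z))
  | knuth₂ (x y z : Fin n) (hxy : x ≤ y) (hyz : y < z) :
      OddPlacticRel n (FreeAlgebra.ι ℤ x * FreeAlgebra.ι ℤ z * FreeAlgebra.ι ℤ y)
        (-(FreeAlgebra.ι ℤ z * FreeAlgebra.ι ℤ x * FreeAlgebra.ι ℤ y))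

/-- The odd plactic ring `ℤPl_n` on `n` letters. -/
def OddPlactic (n : ℕ) : Type := RingQuot (OddPlacticRel n)

noncomputable instance OddPlactic.instRing (n : ℕ) : Ring (OddPlactic n) :=
  inferInstanceAs (Ring (RingQuot (OddPlacticRel n)))

namespace OddPlactic

/-- The quotient map from the free ring. -/
noncomputable def mk (n : ℕ) : FreeAlgebra ℤ (Fin n) →+* OddPlactic n :=
  RingQuot.mkRingHom (OddPlacticRel n)

/-- The class of a one-letter word. -/
noncomputable def letter {n : ℕ} (i : Fin n) : OddPlactic n := mk n (FreeAlgebra.ι ℤ i)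

/-- The class of a word. -/
noncomputable def word {n : ℕ} (w : List (Fin n)) : OddPlactic n := (w.map letter).prod

/-- The ring homomorphism `w ↦ x̃^w` from the odd plactic ring to the skew polynomials,
sending the letter `i` to `x̃_i`. -/
noncomputable def toOPol (n : ℕ) : OddPlactic n →+* OPol n :=
  RingQuot.lift
    ⟨(FreeAlgebra.lift ℤ fun i => (OPol.xt i : OPol n)).toRingHom, by
      rintro _ _ (⟨x, y, z, hxy, hyz⟩ | ⟨x, y, z, hxy, hyz⟩)
      · simp only [AlgHom.toRingHom_eq_coe, RingHom.coe_coe, map_mul, map_neg,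
          FreeAlgebra.lift_ι_apply]
        rw [mul_assoc, OPol.xt_anticomm (hxy.trans_le hyz).ne', mul_neg, mul_assoc]
      · simp only [AlgHom.toRingHom_eq_coe, RingHom.coe_coe, map_mul, map_neg,
          FreeAlgebra.lift_ι_apply]
        rw [OPol.xt_anticomm (hxy.trans_lt hyz).ne, neg_mul]⟩

theorem toOPol_letter {n : ℕ} (i : Fin n) : toOPol n (letter i) = OPol.xt i := by
  unfold toOPol letter mk
  erw [RingQuot.lift_mkRingHom_apply]
  simp

end OddPlactic

/-! ### Tableaux -/

/-- Semistandard Young tableaux of shape `μ` with entries in the `n`-letter alphabet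
`{0, ..., n - 1}`. -/
def BoundedSSYT (n : ℕ) (μ : YoungDiagram) : Type :=
  {T : SemistandardYoungTableau μ // ∀ i j, (i, j) ∈ μ → T i j < n}

instance BoundedSSYT.instFinite (n : ℕ) (μ : YoungDiagram) : Finite (BoundedSSYT n μ) := by
  refine Finite.of_injective
    (fun (T : BoundedSSYT n μ) (c : μ.cells) =>
      (⟨T.1 c.1.1 c.1.2, T.2 _ _ c.2⟩ : Fin n)) ?_
  intro T U h
  apply Subtype.ext
  ext i j
  by_cases hc : (i, j) ∈ μ
  · exact congrArg Fin.val (congrFun h ⟨(i, j), hc⟩)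
  · rw [T.1.zeros hc, U.1.zeros hc]

noncomputable instance BoundedSSYT.instFintype (n : ℕ) (μ : YoungDiagram) :
    Fintype (BoundedSSYT n μ) := Fintype.ofFinite _

/-- The row word of a tableau: its entries read from left to right in each row, the rows being
taken from bottom to top (row `0` is the top row). -/
def BoundedSSYT.rowWord {n : ℕ} {μ : YoungDiagram} (T : BoundedSSYT n μ) : List (Fin n) :=
  (List.range (μ.colLen 0)).reverse.flatMap fun i =>
    List.ofFn fun j : Fin (μ.rowLen i) =>
      (⟨T.1 i j, T.2 i j (YoungDiagram.mem_iff_lt_rowLen.2 j.2)⟩ : Fin n)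

/-- `dN(μ)`: the number of pairs of boxes `(B, C)` with `C` directly North of `B`, that is,
in the same column as `B` and in a strictly higher row. -/
def directNorth (μ : YoungDiagram) : ℕ :=
  ∑ B ∈ μ.cells, (μ.cells.filter fun C => C.1 < B.1 ∧ C.2 = B.2).card

/-- `N(μ)`: the number of pairs of boxes `(B, C)` with `C` in a strictly higher row than `B`. -/
def north (μ : YoungDiagram) : ℕ :=
  ∑ B ∈ μ.cells, (μ.cells.filter fun C => C.1 < B.1).card

/-- The element `ŝ_μ = (-1)^(dN(μ) + N(μ)) ∑_T T` of the odd plactic ring on `n` letters, the sum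
being over the semistandard tableaux `T` of shape `μ`, each standing for its row word. -/
noncomputable def oddPlacticSchur (n : ℕ) (μ : YoungDiagram) : OddPlactic n :=
  (-1) ^ (directNorth μ + north μ) * ∑ T : BoundedSSYT n μ, OddPlactic.word T.rowWord

/-! Everything is controlled by lexicographic leading exponents. Letting skew polynomials act on
ordinary polynomials by signed multiplication shows that the ordered monomials form a basis, so
coefficients make sense up to a fixed choice of signs.

If `∂ f = 0` for neighbouring variables `x_i`, `x_j`, the difference quotient formula
`sq_sub_sq_mul_divDiff` gives `(x_i - x_j) f = s(f) (x_i - x_j)`. Comparing leading terms forces the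
leading exponent of an odd symmetric polynomial to be a partition (`antitone_of_isLead`). In the
plactic ring let `e_m` be the sum of strictly decreasing words of length `m`. Its image is odd
symmetric, and products of such images have every partition as leading exponent with coefficient
`±1`. Successive cancellation of leading terms (`le_of_forall_isLead`) then shows that the algebra
`E` generated by the `e_m` maps onto the odd symmetric polynomials.

It remains to identify `E` with the span of the tableau sums. Signed Schensted insertion yields a
Pieri rule: the sign of inserting a letter depends only on the shape and on the row where the
insertion ends (`tableauWord_mul_letter`), while the row bumping lemma turns "strictly decreasing
letters" into "strictly increasing final rows". Hence multiplication by `e_m` preserves the span,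
and `E` lies in it.

Conversely, the sum over tableaux of shape `λ` maps to an element with leading exponent `λ`,
contributed by the superstandard tableau alone. So the map to skew polynomials is injective on the
span, and all leading exponents in the image of the span are partitions. The cancellation argument
puts that image inside the image of `E`, and injectivity gives equality. The signs in `ŝ_λ` do not
affect the span. -/

/-! ### Monomials and coefficients of skew polynomials -/

namespace OPol

open MvPolynomial in
/-- The automorphism of the polynomial ring changing the sign of the variables before `i`. -/
noncomputable def signHom {n : ℕ} (i : Fin n) :
    MvPolynomial (Fin n) ℤ →ₐ[ℤ] MvPolynomial (Fin n) ℤ :=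
  MvPolynomial.aeval fun j => if j < i then -X j else X j

theorem signHom_X {n : ℕ} (i j : Fin n) :
    signHom i (MvPolynomial.X j) = if j < i then -MvPolynomial.X j else MvPolynomial.X j := by
  simp [signHom]

theorem signHom_comm {n : ℕ} (i j : Fin n) (p : MvPolynomial (Fin n) ℤ) :
    signHom i (signHom j p) = signHom j (signHom i p) := by
  have : (signHom i).comp (signHom j) = (signHom j).comp (signHom i) := by
    apply MvPolynomial.algHom_ext
    intro k
    simp only [AlgHom.comp_apply, signHom_X]
    by_cases hi : k < i <;> by_cases hj : k < j <;> simp [hi, hj, signHom_X]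
  exact congrArg (fun h => h p) this

/-- The action of the generator `x_i` on the polynomial ring. -/
noncomputable def generatorAct {n : ℕ} (i : Fin n) : Module.End ℤ (MvPolynomial (Fin n) ℤ) :=
  (LinearMap.mulLeft ℤ (MvPolynomial.X i)).comp (signHom i).toLinearMap

theorem generatorAct_apply {n : ℕ} (i : Fin n) (p : MvPolynomial (Fin n) ℤ) :
    generatorAct i p = MvPolynomial.X i * signHom i p := rfl

/-- The action of skew polynomials on the polynomial ring. -/
noncomputable def act (n : ℕ) : OPol n →+* Module.End ℤ (MvPolynomial (Fin n) ℤ) :=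
  RingQuot.lift
    ⟨(FreeAlgebra.lift ℤ fun i => generatorAct i).toRingHom, by
      rintro _ _ ⟨i, j, h⟩
      simp only [AlgHom.toRingHom_eq_coe, RingHom.coe_coe, map_add, map_mul, map_zero,
        FreeAlgebra.lift_ι_apply]
      refine LinearMap.ext fun p => ?_
      simp only [LinearMap.add_apply, Module.End.mul_apply, generatorAct_apply, map_mul,
        signHom_X, signHom_comm i j, LinearMap.zero_apply]
      rcases lt_or_gt_of_ne h with h | h <;> simp [h, h.not_gt] <;> ring⟩

theorem act_x {n : ℕ} (i : Fin n) : act n (x i) = generatorAct i := by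
  unfold act x mk
  erw [RingQuot.lift_mkRingHom_apply]
  simp

/-- The additive map from skew polynomials to polynomials sending each monomial to the
corresponding monomial up to sign. -/
noncomputable def toMvPolynomial (n : ℕ) : OPol n →ₗ[ℤ] MvPolynomial (Fin n) ℤ :=
  ((LinearMap.applyₗ (1 : MvPolynomial (Fin n) ℤ)).toAddMonoidHom.comp
    (act n).toAddMonoidHom).toIntLinearMap

theorem toMvPolynomial_one {n : ℕ} : toMvPolynomial n 1 = 1 := by
  simp [toMvPolynomial]

theorem toMvPolynomial_x_mul {n : ℕ} (i : Fin n) (f : OPol n) :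
    toMvPolynomial n (x i * f) = MvPolynomial.X i * signHom i (toMvPolynomial n f) := by
  simp [toMvPolynomial, act_x, generatorAct_apply]

theorem signHom_monomial {n : ℕ} (i : Fin n) (a : Fin n →₀ ℕ) :
    signHom i (MvPolynomial.monomial a 1) = MvPolynomial.monomial a 1 ∨
      signHom i (MvPolynomial.monomial a 1) = -MvPolynomial.monomial a 1 := by
  induction a using Finsupp.induction_linear with
  | zero => left; exact map_one _
  | add f g hf hg =>
    have : MvPolynomial.monomial (f + g) (1 : ℤ)
        = MvPolynomial.monomial f 1 * MvPolynomial.monomial g 1 := by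
      simp [MvPolynomial.monomial_mul]
    rw [this, map_mul]
    rcases hf with hf | hf <;> rcases hg with hg | hg <;> simp [hf, hg]
  | single j k =>
    rw [← MvPolynomial.X_pow_eq_monomial, map_pow, signHom_X]
    split_ifs
    · rw [neg_pow]
      rcases neg_one_pow_eq_or (MvPolynomial (Fin n) ℤ) k with h | h <;> simp [h]
    · simp

/-- The product of the generators along a word. -/
noncomputable def xword {n : ℕ} (w : List (Fin n)) : OPol n := (w.map x).prod

@[simp] theorem xword_nil {n : ℕ} : xword ([] : List (Fin n)) = 1 := rfl

@[simp] theorem xword_cons {n : ℕ} (i : Fin n) (w : List (Fin n)) :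
    xword (i :: w) = x i * xword w := by simp [xword]

theorem xword_append {n : ℕ} (v w : List (Fin n)) : xword (v ++ w) = xword v * xword w := by
  simp [xword]

/-- The exponent vector of a word. -/
noncomputable def content {n : ℕ} (w : List (Fin n)) : Fin n →₀ ℕ := Multiset.toFinsupp (w : Multiset (Fin n))

theorem content_nil {n : ℕ} : content ([] : List (Fin n)) = 0 := by
  simp [content]

theorem content_append {n : ℕ} (v w : List (Fin n)) :
    content (v ++ w) = content v + content w := by
  simp [content, ← Multiset.coe_add]

theorem content_singleton {n : ℕ} (i : Fin n) : content [i] = Finsupp.single i 1 := by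
  simp [content]

theorem content_cons {n : ℕ} (i : Fin n) (w : List (Fin n)) :
    content (i :: w) = Finsupp.single i 1 + content w := by
  rw [← List.singleton_append, content_append, content_singleton]

theorem content_apply {n : ℕ} (w : List (Fin n)) (i : Fin n) : content w i = w.count i := by
  simp [content]

theorem exists_content_eq {n : ℕ} (a : Fin n →₀ ℕ) : ∃ w : List (Fin n), content w = a :=
  ⟨(Finsupp.toMultiset a).toList, by simp [content]⟩

theorem perm_of_content_eq {n : ℕ} {v w : List (Fin n)} (h : content v = content w) :
    v.Perm w := by
  rw [← Multiset.coe_eq_coe]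
  exact Multiset.toFinsupp.injective h

theorem xword_perm {n : ℕ} {v w : List (Fin n)} (h : v.Perm w) :
    xword v = xword w ∨ xword v = -xword w := by
  induction h with
  | nil => simp
  | cons i _ ih => rcases ih with h | h <;> simp [h]
  | swap i j l =>
    by_cases hij : i = j
    · simp [hij]
    · right
      simp only [xword_cons, ← mul_assoc, x_anticomm (Ne.symm hij), neg_mul]
  | trans _ _ h1 h2 => rcases h1 with h1 | h1 <;> rcases h2 with h2 | h2 <;> simp [h1, h2]

theorem toMvPolynomial_xword {n : ℕ} (w : List (Fin n)) :
    toMvPolynomial n (xword w) = MvPolynomial.monomial (content w) 1 ∨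
      toMvPolynomial n (xword w) = -MvPolynomial.monomial (content w) 1 := by
  induction w with
  | nil => left; simp [toMvPolynomial_one, content_nil]
  | cons i w ih =>
    have h : MvPolynomial.monomial (content (i :: w)) (1 : ℤ)
        = MvPolynomial.X i * MvPolynomial.monomial (content w) 1 := by
      rw [content_cons, MvPolynomial.X, MvPolynomial.monomial_mul, one_mul]
    rw [xword_cons, toMvPolynomial_x_mul, h]
    rcases ih with ih | ih <;> rcases signHom_monomial i (content w) with h' | h' <;>
      simp [ih, h']

/-- The coefficient functionals, normalised up to sign. -/
noncomputable def coeff {n : ℕ} (a : Fin n →₀ ℕ) : OPol n →ₗ[ℤ] ℤ :=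
  (MvPolynomial.lcoeff ℤ a).comp (toMvPolynomial n)

/-- Reordering a word only changes the sign of its product, so one signed representative per
exponent vector suffices; the sign is chosen to make its coefficient `+1`. -/
theorem exists_mono {n : ℕ} (a : Fin n →₀ ℕ) :
    ∃ m : OPol n, toMvPolynomial n m = MvPolynomial.monomial a 1 ∧
      ∀ w, content w = a → m = xword w ∨ m = -xword w := by
  obtain ⟨v, hv⟩ := exists_content_eq a
  have key (w) (hw : content w = a) : xword v = xword w ∨ xword v = -xword w :=
    xword_perm (perm_of_content_eq (hv.trans hw.symm))
  rcases toMvPolynomial_xword v with h | h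
  · exact ⟨xword v, by rw [h, hv], key⟩
  · refine ⟨-xword v, by rw [map_neg, h, hv, neg_neg], fun w hw => ?_⟩
    rcases key w hw with h | h <;> simp [h]

/-- The monomial with a given exponent vector, with the sign fixed by `toMvPolynomial`. -/
noncomputable def mono {n : ℕ} (a : Fin n →₀ ℕ) : OPol n := (exists_mono a).choose

theorem mono_eq_xword {n : ℕ} (w : List (Fin n)) :
    mono (content w) = xword w ∨ mono (content w) = -xword w :=
  (exists_mono (content w)).choose_spec.2 w rfl

theorem xword_eq_mono {n : ℕ} (w : List (Fin n)) :
    xword w = mono (content w) ∨ xword w = -mono (content w) := by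
  rcases mono_eq_xword w with h | h <;> simp [h]

theorem coeff_mono {n : ℕ} (a b : Fin n →₀ ℕ) :
    coeff a (mono b) = if b = a then 1 else 0 := by
  simp [coeff, (exists_mono b).choose_spec.1, mono, MvPolynomial.coeff_monomial]

theorem mem_span_range_xword {n : ℕ} (f : OPol n) :
    f ∈ Submodule.span ℤ (Set.range (xword (n := n))) := by
  obtain ⟨p, rfl⟩ : ∃ p, mk n p = f := RingQuot.mkRingHom_surjective (OPolRel n) f
  induction p using FreeAlgebra.induction with
  | grade0 r =>
    simpa using Submodule.smul_mem _ r
      (Submodule.subset_span (Set.mem_range_self (f := xword (n := n)) []))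
  | grade1 j => exact Submodule.subset_span ⟨[j], by simp [x]⟩
  | mul p q hp hq =>
    rw [map_mul]
    have := Submodule.mul_mem_mul hp hq
    rw [Submodule.span_mul_span] at this
    refine Submodule.span_mono ?_ this
    rintro _ ⟨_, ⟨v, rfl⟩, _, ⟨w, rfl⟩, rfl⟩
    exact ⟨v ++ w, xword_append v w⟩
  | add p q hp hq => rw [map_add]; exact add_mem hp hq

theorem mem_span_range_mono {n : ℕ} (f : OPol n) :
    f ∈ Submodule.span ℤ (Set.range (mono (n := n))) := by
  refine Submodule.span_le.2 ?_ (mem_span_range_xword f)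
  rintro _ ⟨w, rfl⟩
  have h : mono (content w) ∈ Submodule.span ℤ (Set.range (mono (n := n))) :=
    Submodule.subset_span ⟨_, rfl⟩
  rcases xword_eq_mono w with hw | hw <;> rw [hw]
  · exact h
  · exact neg_mem h

theorem exists_finsupp_coeff {n : ℕ} (f : OPol n) :
    ∃ c : (Fin n →₀ ℕ) →₀ ℤ, (c.sum fun a r => r • mono a) = f ∧ ∀ a, coeff a f = c a := by
  obtain ⟨c, rfl⟩ := Finsupp.mem_span_range_iff_exists_finsupp.1 (mem_span_range_mono f)
  refine ⟨c, rfl, fun a => ?_⟩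
  simp only [Finsupp.sum, map_sum, map_smul, coeff_mono]
  simp +contextual

theorem eq_zero_of_coeff {n : ℕ} {f : OPol n} (h : ∀ a, coeff a f = 0) : f = 0 := by
  obtain ⟨c, rfl, hc⟩ := exists_finsupp_coeff f
  have : c = 0 := by ext a; rw [← hc, h]; rfl
  simp [this]

/-- A map permuting monomials up to sign permutes coefficients up to sign. -/
theorem coeff_map {n : ℕ} (L : OPol n →ₗ[ℤ] OPol n) (π : (Fin n →₀ ℕ) → Fin n →₀ ℕ)
    (hL : ∀ a, L (mono a) = mono (π a) ∨ L (mono a) = -mono (π a)) (f : OPol n) :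
    (∀ b, coeff b (L f) ≠ 0 → ∃ a, π a = b ∧ coeff a f ≠ 0) ∧
      (π.Injective → ∀ a, coeff (π a) (L f) = coeff a f ∨ coeff (π a) (L f) = -coeff a f) := by
  obtain ⟨c, rfl, hc⟩ := exists_finsupp_coeff f
  simp only [hc]
  simp only [Finsupp.sum, map_sum, map_smul]
  constructor
  · intro b hb
    obtain ⟨a, ha, hab⟩ := Finset.exists_ne_zero_of_sum_ne_zero hb
    refine ⟨a, ?_, by simpa using ha⟩
    by_contra hne
    apply hab
    rcases hL a with h | h <;> simp [h, coeff_mono, hne]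
  · intro hπ a
    have : ∀ a' ∈ c.support, a' ≠ a → c a' • coeff (π a) (L (mono a')) = 0 := by
      intro a' _ hne
      rcases hL a' with h | h <;> simp [h, coeff_mono, hπ.ne hne]
    rw [Finset.sum_eq_single a this (by simp +contextual)]
    rcases hL a with h | h <;> simp [h, coeff_mono]

end OPol

/-! ### Divided differences as difference quotients -/

namespace OPol

theorem induction {n : ℕ} {p : OPol n → Prop} (intCast : ∀ r : ℤ, p r) (x : ∀ i, p (x i))
    (mul : ∀ f g, p f → p g → p (f * g)) (add : ∀ f g, p f → p g → p (f + g)) (f : OPol n) :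
    p f := by
  obtain ⟨q, rfl⟩ : ∃ q, mk n q = f := RingQuot.mkRingHom_surjective (OPolRel n) f
  induction q using FreeAlgebra.induction with
  | grade0 r => simpa using intCast r
  | grade1 j => exact x j
  | mul q r hq hr => rw [map_mul]; exact mul _ _ hq hr
  | add q r hq hr => rw [map_add]; exact add _ _ hq hr

/-- Passing another generator costs two signs, so squares are central. This lets `x_a² - x_b²` serve
as the denominator of the divided difference. -/
theorem x_sq_commute {n : ℕ} (i : Fin n) (f : OPol n) : Commute (x i * x i) f := by
  induction f using OPol.induction with
  | intCast r => exact Int.commute_cast _ r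
  | x j =>
    by_cases h : i = j
    · subst h; exact (Commute.refl _).mul_left (Commute.refl _)
    · rw [Commute, SemiconjBy, mul_assoc, x_anticomm h, mul_neg, ← mul_assoc, x_anticomm h]
      simp [mul_assoc]
  | mul f g hf hg => exact hf.mul_right hg
  | add f g hf hg => exact hf.add_right hg

theorem s_add {n : ℕ} (a b : Fin n) (f g : OPol n) : s a b (f + g) = s a b f + s a b g := by
  simp [s]

theorem s_intCast {n : ℕ} (a b : Fin n) (r : ℤ) : s a b (r : OPol n) = r := by
  simp [s, Matrix.intCast_apply]

theorem divDiff_intCast {n : ℕ} (a b : Fin n) (r : ℤ) : divDiff a b (r : OPol n) = 0 := by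
  simp [divDiff, Matrix.intCast_apply]

/-- The odd divided difference operator as a difference quotient. -/
theorem sq_sub_sq_mul_divDiff {n : ℕ} {a b : Fin n} (hab : a ≠ b) (f : OPol n) :
    (x a * x a - x b * x b) * divDiff a b f = (x a - x b) * f - s a b f * (x a - x b) := by
  induction f using OPol.induction with
  | intCast r =>
    rw [divDiff_intCast, s_intCast, mul_zero, (Int.cast_commute r (x a - x b)).eq, sub_self]
  | x j =>
    rw [divDiff_x, s_x]
    by_cases ha : j = a
    · subst ha
      simp only [true_or, if_true, Equiv.swap_apply_left]
      noncomm_ring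
    · by_cases hb : j = b
      · subst hb
        simp only [or_true, if_true, Equiv.swap_apply_right]
        noncomm_ring
      · rw [Equiv.swap_apply_of_ne_of_ne ha hb, if_neg (by tauto), mul_zero, sub_mul, mul_sub,
          x_anticomm (Ne.symm ha), x_anticomm (Ne.symm hb)]
        noncomm_ring
  | mul f g hf hg =>
    -- Centrality moves the denominator past `s f`; the two middle terms `s(f) (x_a - x_b) g` then
    -- cancel.
    have hc : Commute (x a * x a - x b * x b) (s a b f) :=
      (x_sq_commute a _).sub_left (x_sq_commute b _)
    rw [divDiff_mul, s_mul, mul_add, ← mul_assoc, hf, ← mul_assoc, hc.eq, mul_assoc, hg]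
    noncomm_ring
  | add f g hf hg =>
    rw [divDiff_add, s_add, mul_add, hf, hg]
    noncomm_ring

/-! ### Leading exponents -/

/-- `a` is the lexicographically largest exponent vector occurring in `f`. -/
def IsLead {n : ℕ} (f : OPol n) (a : Fin n →₀ ℕ) : Prop :=
  coeff a f ≠ 0 ∧ ∀ b, coeff b f ≠ 0 → toLex b ≤ toLex a

/-- All exponent vectors occurring in `f` are lexicographically smaller than `a`. -/
def IsBelow {n : ℕ} (f : OPol n) (a : Fin n →₀ ℕ) : Prop :=
  ∀ b, coeff b f ≠ 0 → toLex b < toLex a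

theorem exists_isLead {n : ℕ} {f : OPol n} (hf : f ≠ 0) : ∃ a, IsLead f a := by
  obtain ⟨c, -, hc⟩ := exists_finsupp_coeff f
  have hne : c.support.Nonempty := by
    rw [Finset.nonempty_iff_ne_empty]
    intro h
    refine hf (eq_zero_of_coeff fun a => ?_)
    rw [hc, Finsupp.support_eq_empty.1 h]; rfl
  obtain ⟨a, ha, hmax⟩ := c.support.exists_max_image (fun a => toLex a) hne
  refine ⟨a, by simpa [hc] using ha, fun b hb => hmax b (by simpa [hc] using hb)⟩

theorem IsLead.unique {n : ℕ} {f : OPol n} {a b : Fin n →₀ ℕ} (ha : IsLead f a)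
    (hb : IsLead f b) : a = b :=
  toLex.injective (le_antisymm (hb.2 a ha.1) (ha.2 b hb.1))

theorem IsLead.isBelow {n : ℕ} {f : OPol n} {a b : Fin n →₀ ℕ} (ha : IsLead f a)
    (hab : toLex a < toLex b) : IsBelow f b := fun c hc => (ha.2 c hc).trans_lt hab

theorem isBelow_zero {n : ℕ} (a : Fin n →₀ ℕ) : IsBelow (0 : OPol n) a := by
  simp [IsBelow]

theorem IsBelow.coeff_eq_zero {n : ℕ} {f : OPol n} {a : Fin n →₀ ℕ} (h : IsBelow f a) :
    coeff a f = 0 := by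
  by_contra hne
  exact lt_irrefl _ (h a hne)

theorem IsBelow.neg {n : ℕ} {f : OPol n} {a : Fin n →₀ ℕ} (h : IsBelow f a) :
    IsBelow (-f) a := fun b hb => h b (by simpa using hb)

theorem IsBelow.add {n : ℕ} {f g : OPol n} {a : Fin n →₀ ℕ} (hf : IsBelow f a)
    (hg : IsBelow g a) : IsBelow (f + g) a := by
  intro b hb
  by_cases h : coeff b f = 0
  · exact hg b (by simpa [h] using hb)
  · exact hf b h

theorem IsBelow.sum {n : ℕ} {ι : Type*} {t : Finset ι} {f : ι → OPol n} {a : Fin n →₀ ℕ}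
    (h : ∀ i ∈ t, IsBelow (f i) a) : IsBelow (∑ i ∈ t, f i) a := by
  induction t using Finset.cons_induction with
  | empty => exact isBelow_zero a
  | cons i t hi ih =>
    rw [Finset.sum_cons]
    exact (h i (by simp)).add (ih fun j hj => h j (by simp [hj]))

theorem IsLead.add_isBelow {n : ℕ} {f g : OPol n} {a : Fin n →₀ ℕ} (hf : IsLead f a)
    (hg : IsBelow g a) : IsLead (f + g) a := by
  refine ⟨by simpa [hg.coeff_eq_zero] using hf.1, fun b hb => ?_⟩
  by_cases h : coeff b f = 0
  · exact (hg b (by simpa [h] using hb)).le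
  · exact hf.2 b h

theorem IsLead.neg {n : ℕ} {f : OPol n} {a : Fin n →₀ ℕ} (h : IsLead f a) :
    IsLead (-f) a := by
  simpa [IsLead] using h

theorem IsLead.smul {n : ℕ} {f : OPol n} {a : Fin n →₀ ℕ} (h : IsLead f a) {r : ℤ}
    (hr : r ≠ 0) : IsLead (r • f) a := by
  simpa only [IsLead, map_smul, smul_ne_zero_iff_right hr] using h

theorem x_mul_mono {n : ℕ} (i : Fin n) (a : Fin n →₀ ℕ) :
    x i * mono a = mono (Finsupp.single i 1 + a) ∨
      x i * mono a = -mono (Finsupp.single i 1 + a) := by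
  obtain ⟨w, rfl⟩ := exists_content_eq a
  rw [← content_cons]
  rcases mono_eq_xword w with h | h <;> rcases mono_eq_xword (i :: w) with h' | h' <;>
    simp [h, h']

theorem mono_mul_x {n : ℕ} (i : Fin n) (a : Fin n →₀ ℕ) :
    mono a * x i = mono (Finsupp.single i 1 + a) ∨
      mono a * x i = -mono (Finsupp.single i 1 + a) := by
  obtain ⟨w, rfl⟩ := exists_content_eq a
  rw [add_comm, ← content_singleton, ← content_append]
  rcases mono_eq_xword w with h | h <;> rcases mono_eq_xword (w ++ [i]) with h' | h' <;>
    simp [h, h', xword_append]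

/-- The signed action of a transposition as a linear map. -/
noncomputable def sLin {n : ℕ} (a b : Fin n) : OPol n →ₗ[ℤ] OPol n :=
  (⟨⟨s a b, by simp [s]⟩, s_add a b⟩ : OPol n →+ OPol n).toIntLinearMap

theorem sLin_apply {n : ℕ} (a b : Fin n) (f : OPol n) : sLin a b f = s a b f := rfl

theorem s_xword {n : ℕ} (a b : Fin n) (w : List (Fin n)) :
    s a b (xword w) = xword (w.map (Equiv.swap a b)) ∨
      s a b (xword w) = -xword (w.map (Equiv.swap a b)) := by
  induction w with
  | nil => left; simpa using s_intCast a b 1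
  | cons i w ih =>
    rw [xword_cons, s_mul, s_x]
    rcases ih with h | h <;> simp [h]

theorem content_map {n : ℕ} (σ : Equiv.Perm (Fin n)) (w : List (Fin n)) :
    content (w.map σ) = (content w).equivMapDomain σ := by
  ext i
  rw [Finsupp.equivMapDomain_apply, content_apply, content_apply]
  conv_lhs => rw [← σ.apply_symm_apply i]
  exact List.count_map_of_injective _ _ σ.injective _

theorem sLin_mono {n : ℕ} (i j : Fin n) (a : Fin n →₀ ℕ) :
    sLin i j (mono a) = mono (a.equivMapDomain (Equiv.swap i j)) ∨
      sLin i j (mono a) = -mono (a.equivMapDomain (Equiv.swap i j)) := by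
  obtain ⟨w, rfl⟩ := exists_content_eq a
  rw [← content_map]
  rcases mono_eq_xword w with h | h <;>
    rcases mono_eq_xword (w.map (Equiv.swap i j)) with h' | h' <;>
    rcases s_xword i j w with h'' | h'' <;>
    simp [h, h', ← sLin_apply] at h'' ⊢ <;> simp [h'']

theorem coeff_x_mul {n : ℕ} (i : Fin n) (f : OPol n) (a : Fin n →₀ ℕ) :
    coeff (Finsupp.single i 1 + a) (x i * f) = coeff a f ∨
      coeff (Finsupp.single i 1 + a) (x i * f) = -coeff a f :=
  (coeff_map (LinearMap.mulLeft ℤ (x i)) (fun a => Finsupp.single i 1 + a) (x_mul_mono i) f).2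
    (add_right_injective _) a

theorem IsLead.x_mul {n : ℕ} {f : OPol n} {a : Fin n →₀ ℕ} (h : IsLead f a) (i : Fin n) :
    IsLead (x i * f) (Finsupp.single i 1 + a) := by
  constructor
  · rcases coeff_x_mul i f a with h' | h' <;> rw [h'] <;> simpa using h.1
  · intro b hb
    obtain ⟨c, rfl, hc⟩ := (coeff_map (LinearMap.mulLeft ℤ (x i))
      (fun a => Finsupp.single i 1 + a) (x_mul_mono i) f).1 b hb
    rw [toLex_add, toLex_add]
    exact add_le_add_right (h.2 c hc) _

theorem IsLead.mul_x {n : ℕ} {f : OPol n} {a : Fin n →₀ ℕ} (h : IsLead f a) (i : Fin n) :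
    IsLead (f * x i) (Finsupp.single i 1 + a) := by
  have key := coeff_map (LinearMap.mulRight ℤ (x i))
      (fun a => Finsupp.single i 1 + a) (mono_mul_x i) f
  simp only [LinearMap.mulRight_apply] at key
  constructor
  · rcases key.2 (add_right_injective _) a with h' | h' <;> rw [h'] <;> simpa using h.1
  · intro b hb
    obtain ⟨c, rfl, hc⟩ := key.1 b hb
    rw [toLex_add, toLex_add]
    exact add_le_add_right (h.2 c hc) _

theorem single_lex_lt {n : ℕ} {i j : Fin n} (h : i < j) :
    toLex (Finsupp.single j 1 : Fin n →₀ ℕ) < toLex (Finsupp.single i 1) :=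
  Finsupp.Lex.single_lt_iff.2 h

theorem IsLead.sub_x_mul {n : ℕ} {f : OPol n} {a : Fin n →₀ ℕ} (h : IsLead f a) {i j : Fin n}
    (hij : i < j) : IsLead ((x i - x j) * f) (Finsupp.single i 1 + a) := by
  rw [sub_mul, sub_eq_add_neg]
  refine (h.x_mul i).add_isBelow ((h.x_mul j).isBelow ?_).neg
  rw [toLex_add, toLex_add]
  exact add_lt_add_left (single_lex_lt hij) _

theorem IsLead.mul_sub_x {n : ℕ} {f : OPol n} {a : Fin n →₀ ℕ} (h : IsLead f a) {i j : Fin n}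
    (hij : i < j) : IsLead (f * (x i - x j)) (Finsupp.single i 1 + a) := by
  rw [mul_sub, sub_eq_add_neg]
  refine (h.mul_x i).add_isBelow ((h.mul_x j).isBelow ?_).neg
  rw [toLex_add, toLex_add]
  exact add_lt_add_left (single_lex_lt hij) _

/-- The vanishing gives `(x_i - x_j) f = s(f) (x_i - x_j)`. Since `x_i` leads `x_i - x_j`, both `f`
and `s f` have the same leading exponent. But `s f` also contains that exponent with its entries at
`i` and `j` exchanged, which therefore cannot be larger. -/
theorem le_of_isLead_of_divDiff_eq_zero {n : ℕ} {f : OPol n} {i j : Fin n} (hij : i < j)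
    (hf : divDiff i j f = 0) {a : Fin n →₀ ℕ} (ha : IsLead f a) : a j ≤ a i := by
  have hcomm : (x i - x j) * f = s i j f * (x i - x j) := by
    rw [← sub_eq_zero, ← sq_sub_sq_mul_divDiff hij.ne, hf, mul_zero]
  have key := coeff_map (sLin i j) _ (sLin_mono i j) f
  have hcoeff : coeff (a.equivMapDomain (Equiv.swap i j)) (s i j f) ≠ 0 := by
    rcases key.2 (Finsupp.equivCongrLeft (Equiv.swap i j)).injective a with h | h <;>
      rw [sLin_apply] at h <;> rw [h] <;> simpa using ha.1
  obtain ⟨c, hc⟩ := exists_isLead (f := s i j f) (by rintro h; simp [h] at hcoeff)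
  have hac : a = c := by
    have := (ha.sub_x_mul hij).unique (hcomm ▸ hc.mul_sub_x hij)
    simpa using this
  subst hac
  by_contra! hlt
  -- If `a i < a j`, the exchanged exponent first differs from `a` at position `i`, where it is
  -- larger.
  refine (hc.2 _ hcoeff).not_gt (Finsupp.Lex.lt_iff.2 ⟨i, fun k hk => ?_, ?_⟩)
  · simp [Finsupp.equivMapDomain_apply,
      Equiv.swap_apply_of_ne_of_ne hk.ne (hk.trans hij).ne]
  · simpa [Finsupp.equivMapDomain_apply] using hlt

theorem antitone_of_isLead {n : ℕ} {f : OPol n} (hf : f ∈ OddSymm n) {a : Fin n →₀ ℕ}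
    (ha : IsLead f a) : Antitone a := by
  cases n with
  | zero => exact fun i => i.elim0
  | succ n =>
    refine Fin.antitone_iff_succ_le.2 fun i => ?_
    exact le_of_isLead_of_divDiff_eq_zero Fin.castSucc_lt_succ (hf _ _ (by simp)) ha

/-- A submodule containing an element with each possible leading exponent and unit leading
coefficient is everything. -/
theorem le_of_forall_isLead {n : ℕ} {V W : Submodule ℤ (OPol n)} (hWV : W ≤ V)
    (h : ∀ f ∈ V, ∀ a, IsLead f a → ∃ w ∈ W, IsLead w a ∧ IsUnit (coeff a w)) : V ≤ W := by
  have key : ∀ a : Lex (Fin n →₀ ℕ), ∀ f ∈ V, IsLead f (ofLex a) → f ∈ W := by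
    intro a
    induction a using WellFoundedLT.induction with
    | ind a ih =>
      intro f hf ha
      obtain ⟨w, hw, hwa, hu⟩ := h f hf _ ha
      -- An integer unit is its own inverse, so this product is the quotient of the leading
      -- coefficients, and `f - r • w` loses its leading term.
      set r : ℤ := coeff (ofLex a) f * coeff (ofLex a) w with hr
      have hu2 : coeff (ofLex a) w * coeff (ofLex a) w = 1 := Int.isUnit_mul_self hu
      suffices f - r • w ∈ W by simpa using add_mem this (W.smul_mem r hw)
      by_cases h0 : f - r • w = 0
      · rw [h0]; exact zero_mem _
      obtain ⟨b, hb⟩ := exists_isLead h0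
      refine ih (toLex b) ?_ _ (sub_mem hf (V.smul_mem r (hWV hw))) hb
      have hle : toLex b ≤ a := by
        by_contra hlt
        apply hb.1
        have h1 : coeff b f = 0 := by by_contra h1; exact hlt (ha.2 b h1)
        have h2 : coeff b w = 0 := by by_contra h2; exact hlt (hwa.2 b h2)
        rw [map_sub, map_smul, h1, h2, smul_zero, sub_zero]
      refine lt_of_le_of_ne hle ?_
      rintro rfl
      apply hb.1
      simp only [ofLex_toLex] at hr hu2
      rw [map_sub, map_smul, hr, smul_eq_mul, mul_assoc, hu2, mul_one, sub_self]
  intro f hf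
  by_cases h0 : f = 0
  · rw [h0]; exact zero_mem _
  obtain ⟨a, ha⟩ := exists_isLead h0
  exact key (toLex a) f hf ha

end OPol

/-! ### Elementary symmetric elements -/

namespace OddPlactic

/-- The sum of all strictly decreasing words of length `m` in the letters smaller than `b`. -/
noncomputable def colSum (n : ℕ) : ℕ → ℕ → OddPlactic n
  | 0, _ => 1
  | _ + 1, 0 => 0
  | m + 1, b + 1 => colSum n (m + 1) b + if h : b < n then letter ⟨b, h⟩ * colSum n m b else 0

/-- Sorts the decreasing words by their first letter, which is the largest. -/
theorem colSum_succ (n m b : ℕ) :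
    colSum n (m + 1) b = ∑ i : Fin n with i.val < b, letter i * colSum n m i := by
  induction b with
  | zero => simp [colSum]
  | succ b ih =>
    rw [colSum, ih]
    by_cases h : b < n
    · have : (Finset.univ.filter fun i : Fin n => (i : ℕ) < b + 1)
          = insert ⟨b, h⟩ (Finset.univ.filter fun i : Fin n => (i : ℕ) < b) := by
        ext i
        simp [Fin.ext_iff]
        omega
      rw [this, Finset.sum_insert (by simp), dif_pos h, add_comm]
    · rw [dif_neg h, add_zero]
      congr 1
      ext i
      have := i.2
      simp
      omega

theorem colSum_eq_zero {n m b : ℕ} (h : b < m) : colSum n m b = 0 := by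
  induction b generalizing m with
  | zero => obtain ⟨m, rfl⟩ := Nat.exists_eq_succ_of_ne_zero h.ne'; rfl
  | succ b ih =>
    obtain ⟨m, rfl⟩ := Nat.exists_eq_succ_of_ne_zero (by omega : m ≠ 0)
    rw [colSum, ih (by omega), ih (by omega)]
    simp

end OddPlactic

namespace OPol

open OddPlactic

theorem xt_eq {n : ℕ} (i : Fin n) : xt i = x i ∨ xt i = -x i := by
  unfold xt
  rcases neg_one_pow_eq_or (OPol n) (i : ℕ) with h | h <;> simp [h]

theorem divDiff_neg {n : ℕ} (a b : Fin n) (f : OPol n) : divDiff a b (-f) = -divDiff a b f := by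
  simp [divDiff]

theorem divDiff_zero {n : ℕ} (a b : Fin n) : divDiff a b (0 : OPol n) = 0 := by
  simp [divDiff]

theorem divDiff_one {n : ℕ} (a b : Fin n) : divDiff a b (1 : OPol n) = 0 := by
  simpa using divDiff_intCast a b 1

theorem divDiff_xt_of_ne {n : ℕ} {a b j : Fin n} (ha : j ≠ a) (hb : j ≠ b) :
    divDiff a b (xt j) = 0 := by
  rcases xt_eq j with h | h <;> simp [h, divDiff_neg, divDiff_x, ha, hb]

theorem divDiff_xt_mul_of_ne {n : ℕ} {a b j : Fin n} (ha : j ≠ a) (hb : j ≠ b) {f : OPol n}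
    (hf : divDiff a b f = 0) : divDiff a b (xt j * f) = 0 := by
  rw [divDiff_mul, divDiff_xt_of_ne ha hb, hf, zero_mul, mul_zero, add_zero]

/-- The alternating signs in `x̃` exist for this: neighbouring signed variables have opposite
divided differences. -/
theorem divDiff_xt_add_xt {n : ℕ} {a b : Fin n} (hab : (b : ℕ) = a + 1) :
    divDiff a b (xt a + xt b) = 0 := by
  unfold xt
  rw [hab, pow_succ]
  rcases neg_one_pow_eq_or (OPol n) (a : ℕ) with h | h <;>
    simp [h, divDiff_add, divDiff_neg, divDiff_x]

theorem divDiff_xt_mul_xt {n : ℕ} {a b : Fin n} (hab : (b : ℕ) = a + 1) :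
    divDiff a b (xt b * xt a) = 0 := by
  unfold xt
  rw [hab, pow_succ]
  rcases neg_one_pow_eq_or (OPol n) (a : ℕ) with h | h <;>
    simp [h, divDiff_mul, divDiff_neg, divDiff_x, s_x]

theorem toOPol_colSum_succ {n m b : ℕ} (h : b < n) :
    toOPol n (colSum n (m + 1) (b + 1))
      = toOPol n (colSum n (m + 1) b) + xt ⟨b, h⟩ * toOPol n (colSum n m b) := by
  rw [colSum, dif_pos h, map_add, map_mul, toOPol_letter]

theorem divDiff_toOPol_colSum_of_le {n : ℕ} {i j : Fin n} (hij : (j : ℕ) = i + 1) (m b : ℕ)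
    (hb : b ≤ i) : divDiff i j (toOPol n (colSum n m b)) = 0 := by
  induction b generalizing m with
  | zero => cases m <;> simp [colSum, divDiff_one, divDiff_zero]
  | succ b ih =>
    cases m with
    | zero => simp [colSum, divDiff_one]
    | succ m =>
      have hbn : b < n := by omega
      rw [toOPol_colSum_succ hbn, divDiff_add, ih _ (by omega), zero_add]
      exact divDiff_xt_mul_of_ne (by simp [Fin.ext_iff]; omega) (by simp [Fin.ext_iff]; omega)
        (ih _ (by omega))

/-- Once the letters `i` and `j` are both available, `e_m` splits as `e_m' + (x̃_i + x̃_j) e_{m-1}'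
+ x̃_j x̃_i e_{m-2}'`, with primes denoting sums over letters below `i`; every factor is
annihilated. Letters beyond `j` only multiply annihilated elements from the left. -/
theorem divDiff_toOPol_colSum {n : ℕ} {i j : Fin n} (hij : (j : ℕ) = i + 1) (m b : ℕ)
    (hb : j < b) (hbn : b ≤ n) : divDiff i j (toOPol n (colSum n m b)) = 0 := by
  induction b, hb using Nat.le_induction generalizing m with
  | base =>
    cases m with
    | zero => simp [colSum, divDiff_one]
    | succ m =>
      have low := divDiff_toOPol_colSum_of_le hij (hb := le_rfl)
      have hj : xt ⟨(i : ℕ) + 1, by omega⟩ = xt j := by congr 1; ext; exact hij.symm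
      rw [hij, toOPol_colSum_succ (by omega), toOPol_colSum_succ i.2, hj, add_assoc, divDiff_add,
        low, zero_add]
      cases m with
      | zero => simpa [colSum] using divDiff_xt_add_xt hij
      | succ m =>
        rw [toOPol_colSum_succ i.2, mul_add, ← add_assoc, ← add_mul, ← mul_assoc, divDiff_add,
          divDiff_mul, divDiff_xt_add_xt hij, low, divDiff_mul, divDiff_xt_mul_xt hij, low]
        simp
  | succ b hb ih =>
    cases m with
    | zero => simp [colSum, divDiff_one]
    | succ m =>
      rw [toOPol_colSum_succ (by omega), divDiff_add, ih _ (by omega), zero_add]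
      exact divDiff_xt_mul_of_ne (by simp [Fin.ext_iff]; omega) (by simp [Fin.ext_iff]; omega)
        (ih m (by omega))

theorem toOPol_colSum_mem_oddSymm (n m : ℕ) : toOPol n (colSum n m n) ∈ OddSymm n :=
  fun _ j hij => divDiff_toOPol_colSum hij m n j.2 le_rfl

/-- The exponent vector of `x_1 ⋯ x_m`. -/
noncomputable def colExp (n m : ℕ) : Fin n →₀ ℕ :=
  Finsupp.equivFunOnFinite.symm fun i => if (i : ℕ) < m then 1 else 0

theorem colExp_apply (n m : ℕ) (i : Fin n) : colExp n m i = if (i : ℕ) < m then 1 else 0 := rfl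

theorem colExp_succ {n m : ℕ} (h : m < n) :
    colExp n (m + 1) = Finsupp.single ⟨m, h⟩ 1 + colExp n m := by
  ext i
  simp only [colExp_apply, Finsupp.add_apply, Finsupp.single_apply, Fin.ext_iff]
  split_ifs <;> omega

theorem IsLead.xt_mul {n : ℕ} {f : OPol n} {a : Fin n →₀ ℕ} (h : IsLead f a) (i : Fin n) :
    IsLead (xt i * f) (Finsupp.single i 1 + a) := by
  rcases xt_eq i with hi | hi <;> rw [hi]
  · exact h.x_mul i
  · rw [neg_mul]; exact (h.x_mul i).neg

theorem isUnit_coeff_xt_mul {n : ℕ} {f : OPol n} {a : Fin n →₀ ℕ} (h : IsUnit (coeff a f))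
    (i : Fin n) : IsUnit (coeff (Finsupp.single i 1 + a) (xt i * f)) := by
  rcases xt_eq i with hi | hi <;> rcases coeff_x_mul i f a with h' | h' <;> simp [hi, h', h]

/-- Among decreasing words of length `m`, the one in the first `m` letters has the largest exponent.
Carrying the factor `f` on the right lets the recursion on words run without a general product rule
for leading terms. -/
theorem isLead_toOPol_colSum_mul {n m b : ℕ} (hm : m ≤ b) (hb : b ≤ n) {f : OPol n}
    {a : Fin n →₀ ℕ} (hf : IsLead f a) (hu : IsUnit (coeff a f)) :
    IsLead (toOPol n (colSum n m b) * f) (colExp n m + a) ∧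
      IsUnit (coeff (colExp n m + a) (toOPol n (colSum n m b) * f)) := by
  induction b generalizing m with
  | zero =>
    obtain rfl : m = 0 := by omega
    have : colExp n 0 = 0 := by ext i; simp [colExp_apply]
    simpa [colSum, this] using ⟨hf, hu⟩
  | succ b ih =>
    cases m with
    | zero =>
      have : colExp n 0 = 0 := by ext i; simp [colExp_apply]
      simpa [colSum, this] using ⟨hf, hu⟩
    | succ m =>
      rw [toOPol_colSum_succ hb, add_mul, mul_assoc]
      obtain ⟨h1, h2⟩ := ih (m := m) (by omega) (by omega)
      rcases (by omega : m = b ∨ m + 1 ≤ b) with rfl | hlt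
      · rw [colSum_eq_zero (Nat.lt_succ_self m), map_zero, zero_mul, zero_add, colExp_succ hb,
          add_assoc]
        exact ⟨h1.xt_mul _, isUnit_coeff_xt_mul h2 _⟩
      · obtain ⟨h3, h4⟩ := ih hlt (by omega)
        -- Words using the letter `b` lead with `x_b` where the top word has the earlier variable of
        -- index `m < b`.
        have hbelow : IsBelow (xt ⟨b, hb⟩ * (toOPol n (colSum n m b) * f))
            (colExp n (m + 1) + a) := by
          refine (h1.xt_mul ⟨b, hb⟩).isBelow ?_
          rw [colExp_succ (by omega), add_assoc, toLex_add, toLex_add]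
          refine add_lt_add_left (single_lex_lt ?_) _
          exact hlt
        refine ⟨h3.add_isBelow hbelow, ?_⟩
        rwa [map_add, hbelow.coeff_eq_zero, add_zero]

end OPol

/-! ### Generation of the odd symmetric polynomials by elementary ones -/

namespace OddPlactic

/-- The subalgebra generated by the elementary symmetric elements. -/
noncomputable def elementaryAlgebra (n : ℕ) : Subalgebra ℤ (OddPlactic n) :=
  Algebra.adjoin ℤ (Set.range fun m => colSum n m n)

theorem toOPol_mem_oddSymm {n : ℕ} {f : OddPlactic n} (hf : f ∈ elementaryAlgebra n) :
    toOPol n f ∈ OddSymm n := by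
  have : elementaryAlgebra n ≤ (OddSymm n).comap (toOPol n).toIntAlgHom := by
    refine Algebra.adjoin_le ?_
    rintro _ ⟨m, rfl⟩
    exact OPol.toOPol_colSum_mem_oddSymm n m
  exact this hf

open OPol in
-- Strips off the first column of the partition `a`: its height `m` is the number of nonzero
-- entries, what is left is again a partition, and multiplying by `e_m` restores the column.
theorem exists_isLead_of_antitone {n : ℕ} (a : Fin n →₀ ℕ) (ha : Antitone a) :
    ∃ f ∈ elementaryAlgebra n, IsLead (toOPol n f) a ∧ IsUnit (coeff a (toOPol n f)) := by
  induction hd : ∑ i, a i using Nat.strong_induction_on generalizing a with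
  | _ d ih =>
    by_cases h0 : a = 0
    · subst h0
      have h1 (b : Fin n →₀ ℕ) : coeff b (1 : OPol n) = if b = 0 then 1 else 0 := by
        rw [coeff, LinearMap.comp_apply, toMvPolynomial_one]
        simp [MvPolynomial.coeff_one, eq_comm]
      exact ⟨1, one_mem _, by simp [IsLead, h1]⟩
    -- The support of a weakly decreasing vector is an initial segment.
    have hsupp (i : Fin n) : (i : ℕ) < a.support.card ↔ a i ≠ 0 := by
      have := i.2
      constructor
      · intro h hi
        have : a.support ⊆ Finset.Iio i := fun j hj => by
          by_contra hlt
          have := ha (not_lt.1 (by simpa using hlt))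
          simp at hj
          omega
        have := Finset.card_le_card this
        rw [Fin.card_Iio] at this
        omega
      · intro hi
        have : Finset.Iic i ⊆ a.support := fun j hj => by
          have := ha (Finset.mem_Iic.1 hj)
          simp
          omega
        have := Finset.card_le_card this
        rw [Fin.card_Iic] at this
        omega
    set m := a.support.card with hm
    have hle : colExp n m ≤ a := by
      intro i
      rw [colExp_apply]
      split_ifs with h
      · exact Nat.one_le_iff_ne_zero.2 ((hsupp i).1 h)
      · exact Nat.zero_le _
    obtain ⟨f, hf, h1, h2⟩ := ih (∑ i, (a - colExp n m) i) (by
      obtain ⟨i, hi⟩ := Finsupp.ne_iff.1 h0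
      rw [← hd]
      refine Finset.sum_lt_sum (fun j _ => by simp) ⟨i, Finset.mem_univ i, ?_⟩
      have := (hsupp i).2 hi
      rw [Finsupp.tsub_apply, colExp_apply, if_pos this]
      have : a i ≠ 0 := hi
      omega) (a - colExp n m) (by
      intro i j hij
      have h1 := hsupp i
      have h2 := hsupp j
      have h3 := ha hij
      have h4 : (i : ℕ) ≤ j := hij
      rw [Finsupp.tsub_apply, Finsupp.tsub_apply, colExp_apply, colExp_apply]
      split_ifs <;> omega) rfl
    have hmn : m ≤ n := by simpa using Finset.card_le_univ a.support
    have := isLead_toOPol_colSum_mul hmn le_rfl h1 h2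
    rw [add_tsub_cancel_of_le hle, ← map_mul] at this
    exact ⟨colSum n m n * f, mul_mem (Algebra.subset_adjoin ⟨m, rfl⟩) hf, this⟩

/-- Every odd symmetric polynomial is a polynomial in the elementary ones. -/
theorem oddSymm_le_map (n : ℕ) :
    Subalgebra.toSubmodule (OddSymm n) ≤
      (Subalgebra.toSubmodule (elementaryAlgebra n)).map
        (toOPol n).toIntAlgHom.toLinearMap := by
  refine OPol.le_of_forall_isLead ?_ ?_
  · rintro _ ⟨f, hf, rfl⟩
    exact toOPol_mem_oddSymm hf
  · intro f hf a ha
    obtain ⟨w, hw, h1, h2⟩ := exists_isLead_of_antitone a (OPol.antitone_of_isLead hf ha)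
    exact ⟨_, ⟨w, hw, rfl⟩, h1, h2⟩

end OddPlactic

/-! ### Row insertion into tableaux given as lists of rows -/

theorem headD_map_length {β : Type*} (t : List (List β)) :
    (t.map List.length).headD 0 = (t.headD []).length := by
  cases t <;> rfl

section Insertion

variable {α : Type*} [LinearOrder α]

/-- Schensted insertion of a letter into a row, with the bumped letter (if any) and the
resulting row. -/
inductive RowInsert : List α → α → Option α → List α → Prop
  | nil (x : α) : RowInsert [] x none [x]
  | here {a x : α} {r : List α} (h : x < a) : RowInsert (a :: r) x (some a) (x :: r)
  | there {a x : α} {o : Option α} {r r' : List α} (h : a ≤ x) (h' : RowInsert r x o r') :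
      RowInsert (a :: r) x o (a :: r')

/-- The row `r` may stand directly above the row `s` in a column strict tableau. -/
inductive RowDom : List α → List α → Prop
  | nil (r : List α) : RowDom r []
  | cons {a b : α} {r s : List α} (h : a < b) (h' : RowDom r s) : RowDom (a :: r) (b :: s)

/-! ### Insertion into a single row -/

namespace RowInsert

theorem exists_insert (r : List α) (x : α) : ∃ o r', RowInsert r x o r' := by
  induction r with
  | nil => exact ⟨_, _, .nil x⟩
  | cons a r ih =>
    rcases lt_or_ge x a with h | h
    · exact ⟨_, _, .here h⟩
    · obtain ⟨o, r', h'⟩ := ih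
      exact ⟨_, _, .there h h'⟩

theorem unique {r r' r'' : List α} {x : α} {o p : Option α} (h : RowInsert r x o r')
    (h' : RowInsert r x p r'') : o = p ∧ r' = r'' := by
  induction h generalizing r'' with
  | nil x => cases h'; simp
  | here h =>
    cases h' with
    | here => simp
    | there h1 => exact absurd h h1.not_gt
  | there h _ ih =>
    cases h' with
    | here h1 => exact absurd h1 h.not_gt
    | there _ h2 => simpa using ih h2

theorem length_none {r r' : List α} {x : α} (h : RowInsert r x none r') :
    r'.length = r.length + 1 := by
  generalize ho : (none : Option α) = o at h
  induction h <;> simp_all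

theorem length_some {r r' : List α} {x y : α} (h : RowInsert r x (some y) r') :
    r'.length = r.length := by
  generalize ho : some y = o at h
  induction h <;> simp_all

theorem mem_self {r r' : List α} {x : α} {o : Option α} (h : RowInsert r x o r') : x ∈ r' := by
  induction h <;> simp_all

theorem mem_of_mem {r r' : List α} {x : α} {o : Option α} (h : RowInsert r x o r') {b : α}
    (hb : b ∈ r') : b = x ∨ b ∈ r := by
  induction h with
  | nil => simpa using hb
  | here => simp at hb ⊢; tauto
  | there _ _ ih => simp at hb ⊢; tauto

theorem some_mem {r r' : List α} {x y : α} (h : RowInsert r x (some y) r') : y ∈ r := by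
  generalize ho : some y = o at h
  induction h <;> simp_all

theorem lt_some {r r' : List α} {x y : α} (h : RowInsert r x (some y) r') : x < y := by
  generalize ho : some y = o at h
  induction h <;> simp_all

theorem pairwise {r r' : List α} {x : α} {o : Option α} (h : RowInsert r x o r')
    (hr : r.Pairwise (· ≤ ·)) : r'.Pairwise (· ≤ ·) := by
  induction h with
  | nil => simp
  | here h =>
    rw [List.pairwise_cons] at hr ⊢
    exact ⟨fun b hb => h.le.trans (hr.1 b hb), hr.2⟩
  | there h h' ih =>
    rw [List.pairwise_cons] at hr ⊢
    refine ⟨fun b hb => ?_, ih hr.2⟩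
    rcases h'.mem_of_mem hb with rfl | hb
    · exact h
    · exact hr.1 b hb

theorem exists_of_ne_nil {r' : List α} (hr : r'.Pairwise (· ≤ ·)) (hne : r' ≠ []) :
    ∃ r x, r.Pairwise (· ≤ ·) ∧ RowInsert r x none r' := by
  induction r' with
  | nil => exact absurd rfl hne
  | cons a r' ih =>
    rw [List.pairwise_cons] at hr
    rcases eq_or_ne r' [] with rfl | h
    · exact ⟨[], a, by simp, .nil a⟩
    · obtain ⟨r, x, h1, h2⟩ := ih hr.2 h
      refine ⟨a :: r, x, ?_, .there (hr.1 x h2.mem_self) h2⟩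
      rw [List.pairwise_cons]
      refine ⟨fun b hb => hr.1 b ?_, h1⟩
      -- Nothing is bumped, so every entry of `r` survives in `r'`.
      clear ih hr h h1
      generalize ho : (none : Option α) = o at h2
      induction h2 <;> simp_all
      tauto

theorem injective_none {r s r' : List α} {x z : α} (h : RowInsert r x none r')
    (h' : RowInsert s z none r') : r = s ∧ x = z := by
  generalize ho : (none : Option α) = o at h
  induction h generalizing s with
  | nil =>
    cases h' with
    | nil => simp
    | there _ h => cases h
  | here => cases ho
  | there _ h ih =>
    cases h' with
    | nil => cases h
    | there _ h2 => simpa using ih h2 ho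

/-- Reverse bumping: `y` replaces the rightmost entry smaller than `y`, and that entry is the letter
expelled. -/
theorem exists_of_mem_lt {r' : List α} {y : α} (hr : r'.Pairwise (· ≤ ·))
    (hy : ∃ a ∈ r', a < y) : ∃ r x, r.Pairwise (· ≤ ·) ∧ RowInsert r x (some y) r' := by
  induction r' with
  | nil => simp at hy
  | cons a r' ih =>
    rw [List.pairwise_cons] at hr
    by_cases h : ∃ b ∈ r', b < y
    · obtain ⟨r, x, h1, h2⟩ := ih hr.2 h
      refine ⟨a :: r, x, ?_, .there (hr.1 x h2.mem_self) h2⟩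
      rw [List.pairwise_cons]
      refine ⟨fun b hb => ?_, h1⟩
      have hay : a ≤ y := (hr.1 x h2.mem_self).trans h2.lt_some.le
      clear ih h h1 hy
      generalize ho : some y = o at h2
      induction h2 with
      | nil => cases ho
      | here => grind
      | there _ _ ih => grind
    · push Not at h
      have hay : a < y := by
        obtain ⟨b, hb, hby⟩ := hy
        rcases List.mem_cons.1 hb with rfl | hb
        · exact hby
        · exact absurd hby (h b hb).not_gt
      exact ⟨y :: r', a, List.pairwise_cons.2 ⟨h, hr.2⟩, .here hay⟩

theorem injective_some {r s r' : List α} {x y z : α} (hr : r.Pairwise (· ≤ ·))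
    (hs : s.Pairwise (· ≤ ·)) (h : RowInsert r x (some y) r')
    (h' : RowInsert s z (some y) r') : r = s ∧ x = z := by
  generalize ho : some y = o at h
  induction h generalizing s with
  | nil => cases ho
  | here h =>
    cases ho
    cases h' with
    | here => simp
    | there _ h2 =>
      rw [List.pairwise_cons] at hr
      exact absurd h2.lt_some (hr.1 _ h2.mem_self).not_gt
  | there _ h ih =>
    subst ho
    cases h' with
    | here =>
      rw [List.pairwise_cons] at hs
      exact absurd h.lt_some (hs.1 _ h.mem_self).not_gt
    | there _ h2 =>
      rw [List.pairwise_cons] at hr hs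
      simpa using ih hr.2 hs.2 h2 rfl

theorem exists_some_le {r r' : List α} {x y : α} {p : Option α} (h : RowInsert r x p r')
    (hr : r.Pairwise (· ≤ ·)) (hy : y ∈ r) (hxy : x < y) : ∃ w, p = some w ∧ w ≤ y := by
  induction h with
  | nil => simp at hy
  | here =>
    rcases List.mem_cons.1 hy with rfl | hy
    · exact ⟨_, rfl, le_rfl⟩
    · exact ⟨_, rfl, (List.pairwise_cons.1 hr).1 _ hy⟩
  | there h _ ih =>
    rcases List.mem_cons.1 hy with rfl | hy
    · exact absurd hxy h.not_gt
    · exact ih (List.pairwise_cons.1 hr).2 hy hxy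

/-- Inserting a weakly larger letter next bumps strictly further to the right, where the entries of
the sorted row are at least `z`. -/
theorem le_of_some_some {r r' r'' : List α} {x y z w : α} (hr : r.Pairwise (· ≤ ·))
    (h : RowInsert r y (some z) r') (h' : RowInsert r' x (some w) r'') (hyx : y ≤ x) :
    z ≤ w := by
  generalize ho : some z = o at h
  induction h generalizing r'' with
  | nil => cases ho
  | here h =>
    cases ho
    rw [List.pairwise_cons] at hr
    cases h' with
    | here h1 => exact absurd h1 hyx.not_gt
    | there _ h2 => exact hr.1 _ h2.some_mem
  | there h _ ih =>
    cases h' with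
    | here h1 => exact absurd h1 (h.trans hyx).not_gt
    | there _ h2 => exact ih (List.pairwise_cons.1 hr).2 h2 hyx ho

theorem eq_none_of_none {r r' r'' : List α} {x y : α} {p : Option α}
    (h : RowInsert r y none r') (h' : RowInsert r' x p r'') (hyx : y ≤ x) : p = none := by
  generalize ho : (none : Option α) = o at h
  induction h generalizing r'' with
  | nil =>
    cases h' with
    | here h1 => exact absurd h1 hyx.not_gt
    | there _ h2 => cases h2; rfl
  | here => cases ho
  | there h _ ih =>
    cases h' with
    | here h1 => exact absurd h1 (h.trans hyx).not_gt
    | there _ h2 => exact ih h2 hyx ho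

end RowInsert

/-! ### Column strictness under insertion and its reversal -/

namespace RowDom

theorem length_le {r s : List α} (h : RowDom r s) : s.length ≤ r.length := by
  induction h <;> simp_all

theorem insert_left {r r' s : List α} {x : α} {o : Option α} (h : RowDom r s)
    (hr : RowInsert r x o r') : RowDom r' s := by
  induction hr generalizing s with
  | nil => cases h; exact .nil _
  | here h1 =>
    cases h with
    | nil => exact .nil _
    | cons h2 h3 => exact .cons (h1.trans h2) h3
  | there _ _ ih =>
    cases h with
    | nil => exact .nil _
    | cons h2 h3 => exact .cons h2 (ih h3)

/-- The entry below the bumped `y` exceeds `y`, so `y` lands weakly to the left of the column it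
left; above its new place stands an entry smaller than `y`. -/
theorem insert {r r' s s' : List α} {x y : α} {o : Option α} (h : RowDom r s)
    (hr : RowInsert r x (some y) r') (hs : RowInsert s y o s') : RowDom r' s' := by
  generalize hp : some y = p at hr
  induction hr generalizing s s' with
  | nil => cases hp
  | here h1 =>
    cases hp
    cases h with
    | nil => cases hs; exact .cons h1 (.nil _)
    | cons h2 h3 =>
      cases hs with
      | here => exact .cons h1 h3
      | there h4 => exact absurd h2 h4.not_gt
  | there h1 h2 ih =>
    subst hp
    have hay := h1.trans_lt h2.lt_some
    cases h with
    | nil => cases hs; exact .cons hay (.nil _)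
    | cons h3 h4 =>
      cases hs with
      | here => exact .cons hay (h4.insert_left h2)
      | there _ h5 => exact .cons h3 (ih h4 h5 rfl)

/-- The entry directly above the inserted `y` is smaller, which is exactly what reverse bumping of
`y` into the upper row requires. -/
theorem exists_lt {r s s' : List α} {y : α} {o : Option α} (h : RowDom r s')
    (hs : RowInsert s y o s') : ∃ a ∈ r, a < y := by
  induction hs generalizing r with
  | nil => cases h with | cons h1 _ => exact ⟨_, by simp, h1⟩
  | here => cases h with | cons h1 _ => exact ⟨_, by simp, h1⟩
  | there _ _ ih =>
    cases h with
    | cons h1 h2 =>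
      obtain ⟨a, ha, hay⟩ := ih h2
      exact ⟨a, by simp [ha], hay⟩

theorem of_insert_left_of_lt {r r' s : List α} {x y : α} (h : RowDom r' s)
    (hr : RowInsert r x (some y) r') (hs : ∀ b ∈ s, y < b) : RowDom r s := by
  generalize hp : some y = p at hr
  induction hr generalizing s with
  | nil => cases hp
  | here h1 =>
    cases hp
    cases h with
    | nil => exact .nil _
    | cons _ h3 => exact .cons (hs _ (by simp)) h3
  | there h1 h2 ih =>
    cases h with
    | nil => exact .nil _
    | cons h3 h4 => exact .cons h3 (ih h4 (fun b hb => hs b (by simp [hb])) hp)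

theorem of_insert {r r' s s' : List α} {x y : α} {o : Option α} (h : RowDom r' s')
    (hr : RowInsert r x (some y) r') (hs : RowInsert s y o s') (hr' : r.Pairwise (· ≤ ·))
    (hs' : s.Pairwise (· ≤ ·)) : RowDom r s := by
  generalize hp : some y = p at hr
  induction hr generalizing s s' with
  | nil => cases hp
  | here h1 =>
    cases hp
    rw [List.pairwise_cons] at hr'
    cases hs with
    | nil => exact .nil _
    | here h2 => cases h with | cons _ h4 => exact .cons h2 h4
    | there _ h3 =>
      cases h with
      | cons _ h5 =>
        -- If `y` had been inserted strictly to the right of its old column, the entry above it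
        -- would be smaller than `y` yet follow `y` in the sorted row `r`.
        obtain ⟨a, ha, hlt⟩ := h5.exists_lt h3
        exact absurd hlt (hr'.1 a ha).not_gt
  | there h1 h2 ih =>
    subst hp
    rw [List.pairwise_cons] at hr'
    cases hs with
    | nil => exact .nil _
    | here h3 =>
      rw [List.pairwise_cons] at hs'
      cases h with
      | cons h4 h5 =>
        exact .cons (h4.trans h3) (h5.of_insert_left_of_lt h2 fun b hb => h3.trans_le (hs'.1 b hb))
    | there _ h3 =>
      rw [List.pairwise_cons] at hs'
      cases h with
      | cons h4 h5 => exact .cons h4 (ih h5 h3 hr'.2 hs'.2 rfl)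

/-- Only the last box of `r'` is removed; the length bound says that nothing stands below it. -/
theorem of_insert_none {r r' s : List α} {x : α} (h : RowDom r' s)
    (hr : RowInsert r x none r') (hs : s.length ≤ r.length) : RowDom r s := by
  generalize hp : (none : Option α) = p at hr
  induction hr generalizing s with
  | nil =>
    obtain rfl : s = [] := by simpa using hs
    exact .nil _
  | here => cases hp
  | there _ _ ih =>
    cases h with
    | nil => exact .nil _
    | cons h1 h2 => exact .cons h1 (ih h2 (by simpa using hs) hp)

end RowDom

/-- Semistandard tableaux as lists of nonempty rows, from top to bottom. -/
def IsTableau : List (List α) → Prop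
  | [] => True
  | r :: t => r ≠ [] ∧ r.Pairwise (· ≤ ·) ∧ RowDom r (t.headD []) ∧ IsTableau t

/-- Row insertion of a letter into a tableau; the number is the index of the row in which the
insertion ends. -/
inductive Inserts : ℕ → List (List α) → α → List (List α) → Prop
  | nil (x : α) : Inserts 0 [] x [[x]]
  | append {r r' : List α} {t : List (List α)} {x : α} (h : RowInsert r x none r') :
      Inserts 0 (r :: t) x (r' :: t)
  | bump {r r' : List α} {t t' : List (List α)} {x y : α} {i : ℕ}
      (h : RowInsert r x (some y) r') (h' : Inserts i t y t') :
      Inserts (i + 1) (r :: t) x (r' :: t')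

/-- Weakly decreasing lists of positive numbers. -/
def IsPartitionList : List ℕ → Prop
  | [] => True
  | a :: l => 0 < a ∧ l.headD 0 ≤ a ∧ IsPartitionList l

/-- The list obtained by increasing the entry of index `i` by one. -/
def addBox : ℕ → List ℕ → List ℕ
  | 0, [] => [1]
  | 0, a :: l => (a + 1) :: l
  | _ + 1, [] => []
  | i + 1, a :: l => a :: addBox i l

theorem IsTableau.pairwise_headD {t : List (List α)} (h : IsTableau t) :
    (t.headD []).Pairwise (· ≤ ·) := by
  cases t with
  | nil => simp
  | cons r t => exact h.2.1

theorem IsTableau.isPartitionList {t : List (List α)} (h : IsTableau t) :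
    IsPartitionList (t.map List.length) := by
  induction t with
  | nil => trivial
  | cons r t ih =>
    obtain ⟨h1, _, h3, h4⟩ := h
    exact ⟨List.length_pos_iff.2 h1, by rw [headD_map_length]; exact h3.length_le, ih h4⟩

/-! ### Insertion into tableaux, its reversal and row bumping -/

namespace Inserts

theorem exists_inserts (t : List (List α)) (x : α) : ∃ i t', Inserts i t x t' := by
  induction t generalizing x with
  | nil => exact ⟨_, _, .nil x⟩
  | cons r t ih =>
    obtain ⟨o, r', h⟩ := RowInsert.exists_insert r x
    cases o with
    | none => exact ⟨_, _, .append h⟩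
    | some y =>
      obtain ⟨i, t', h'⟩ := ih y
      exact ⟨_, _, .bump h h'⟩

theorem unique {i j : ℕ} {t t' t'' : List (List α)} {x : α} (h : Inserts i t x t')
    (h' : Inserts j t x t'') : i = j ∧ t' = t'' := by
  induction h generalizing j t'' with
  | nil => cases h'; simp
  | append h =>
    cases h' with
    | append h1 => simp [(h.unique h1).2]
    | bump h1 _ => simpa using (h.unique h1).1
  | bump h _ ih =>
    cases h' with
    | append h1 => simpa using (h.unique h1).1
    | bump h1 h2 =>
      obtain ⟨h3, rfl⟩ := h.unique h1
      cases h3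
      simpa using ih h2

theorem headD {i : ℕ} {t t' : List (List α)} {x : α} (h : Inserts i t x t') :
    ∃ o, RowInsert (t.headD []) x o (t'.headD []) := by
  cases h with
  | nil => exact ⟨_, .nil x⟩
  | append h => exact ⟨_, h⟩
  | bump h _ => exact ⟨_, h⟩

theorem isTableau {i : ℕ} {t t' : List (List α)} {x : α} (h : Inserts i t x t')
    (ht : IsTableau t) : IsTableau t' := by
  induction h with
  | nil => exact ⟨by simp, by simp, .nil _, trivial⟩
  | append h =>
    obtain ⟨_, h2, h3, h4⟩ := ht
    exact ⟨List.ne_nil_of_mem h.mem_self, h.pairwise h2, h3.insert_left h, h4⟩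
  | bump h h' ih =>
    obtain ⟨_, h2, h3, h4⟩ := ht
    obtain ⟨o, ho⟩ := h'.headD
    exact ⟨List.ne_nil_of_mem h.mem_self, h.pairwise h2, h3.insert h ho, ih h4⟩

theorem map_length {i : ℕ} {t t' : List (List α)} {x : α} (h : Inserts i t x t') :
    t'.map List.length = addBox i (t.map List.length) := by
  induction h with
  | nil => simp [addBox]
  | append h => simp [addBox, h.length_none]
  | bump h _ ih => simp [addBox, h.length_some, ih]

theorem le_length {i : ℕ} {t t' : List (List α)} {x : α} (h : Inserts i t x t') :
    i ≤ t.length := by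
  induction h <;> simp_all

/-- Row insertion can be reversed. -/
theorem exists_reverse {i : ℕ} {l : List ℕ} (hl : IsPartitionList l) (hi : i ≤ l.length)
    {t' : List (List α)} (ht' : IsTableau t') (hs : t'.map List.length = addBox i l) :
    ∃ t x, IsTableau t ∧ t.map List.length = l ∧ Inserts i t x t' := by
  induction i generalizing l t' with
  | zero =>
    cases l with
    | nil =>
      obtain ⟨r, rfl⟩ : ∃ r, t' = [r] :=
        List.length_eq_one_iff.1 (by simpa [addBox] using congrArg List.length hs)
      obtain ⟨x, rfl⟩ : ∃ x, r = [x] := List.length_eq_one_iff.1 (by simpa [addBox] using hs)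
      exact ⟨[], x, trivial, rfl, .nil x⟩
    | cons a l =>
      cases t' with
      | nil => simp [addBox] at hs
      | cons r' t =>
        simp only [addBox, List.map_cons, List.cons.injEq] at hs
        obtain ⟨h1, h2, h3, h4⟩ := ht'
        obtain ⟨r, x, h5, h6⟩ := RowInsert.exists_of_ne_nil h2 h1
        have hlen : r.length = a := by have := h6.length_none; omega
        refine ⟨r :: t, x, ⟨?_, h5, ?_, h4⟩, by simp [hlen, hs.2], .append h6⟩
        · rw [← List.length_pos_iff, hlen]; exact hl.1
        · refine h3.of_insert_none h6 ?_
          rw [hlen, ← headD_map_length, hs.2]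
          exact hl.2.1
  | succ i ih =>
    cases l with
    | nil => simp at hi
    | cons a l =>
      cases t' with
      | nil => simp [addBox] at hs
      | cons r' t' =>
        simp only [addBox, List.map_cons, List.cons.injEq] at hs
        obtain ⟨h1, h2, h3, h4⟩ := ht'
        obtain ⟨t, y, h5, h6, h7⟩ := ih hl.2.2 (by simpa using hi) h4 hs.2
        obtain ⟨o, h8⟩ := h7.headD
        -- The letter `y` recovered from the lower rows has a smaller entry above it, so it can be
        -- bumped back into the top row.
        obtain ⟨r, x, h9, h10⟩ := RowInsert.exists_of_mem_lt h2 (h3.exists_lt h8)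
        have hlen : r.length = a := by rw [← h10.length_some, hs.1]
        refine ⟨r :: t, x, ⟨?_, h9, ?_, h5⟩, by simp [hlen, h6], .bump h10 h7⟩
        · rw [← List.length_pos_iff, hlen]; exact hl.1
        · exact h3.of_insert h10 h8 h9 h5.pairwise_headD

theorem injective {i : ℕ} {t s t' : List (List α)} {x z : α} (ht : IsTableau t)
    (hs : IsTableau s) (h : Inserts i t x t') (h' : Inserts i s z t') : t = s ∧ x = z := by
  induction h generalizing s z with
  | nil =>
    cases h' with
    | nil => simp
    | append h1 =>
      cases h1 with
      | nil => exact absurd rfl hs.1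
      | there _ h2 => cases h2
  | append h =>
    cases h' with
    | nil =>
      cases h with
      | nil => exact absurd rfl ht.1
      | there _ h2 => cases h2
    | append h1 => simpa using h.injective_none h1
  | bump h _ ih =>
    cases h' with
    | bump h1 h2 =>
      obtain ⟨rfl, rfl⟩ := ih ht.2.2.2 hs.2.2.2 h2
      simpa using RowInsert.injective_some ht.2.1 hs.2.1 h h1

/-- Since `y` now lies in the top row and `x < y`, inserting `x` must bump a letter `w ≤ y`. If `y`
bumped some `z`, then `w ≤ y < z`, so the strict comparison is passed to the next row. -/
theorem lt_of_lt {i j : ℕ} {t t' t'' : List (List α)} {x y : α} (ht : IsTableau t)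
    (h : Inserts i t y t') (h' : Inserts j t' x t'') (hxy : x < y) : i < j := by
  induction h generalizing j t'' x with
  | nil =>
    cases h' with
    | append h1 =>
      obtain ⟨w, hw, _⟩ := h1.exists_some_le (by simp) (List.mem_singleton_self _) hxy
      cases hw
    | bump => omega
  | append h =>
    cases h' with
    | append h1 =>
      obtain ⟨w, hw, _⟩ := h1.exists_some_le (h.pairwise ht.2.1) h.mem_self hxy
      cases hw
    | bump => omega
  | bump h _ ih =>
    cases h' with
    | append h1 =>
      obtain ⟨w, hw, _⟩ := h1.exists_some_le (h.pairwise ht.2.1) h.mem_self hxy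
      cases hw
    | bump h1 h2 =>
      obtain ⟨w, hw, hwy⟩ := h1.exists_some_le (h.pairwise ht.2.1) h.mem_self hxy
      cases hw
      have := ih ht.2.2.2 h2 (hwy.trans_lt h.lt_some)
      omega

theorem le_of_le {i j : ℕ} {t t' t'' : List (List α)} {x y : α} (ht : IsTableau t)
    (h : Inserts i t y t') (h' : Inserts j t' x t'') (hyx : y ≤ x) : j ≤ i := by
  induction h generalizing j t'' x with
  | nil =>
    cases h' with
    | append => omega
    | bump h1 _ => cases (RowInsert.nil _).eq_none_of_none h1 hyx
  | append h =>
    cases h' with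
    | append => omega
    | bump h1 _ => cases h.eq_none_of_none h1 hyx
  | bump h _ ih =>
    cases h' with
    | append => omega
    | bump h1 h2 =>
      have := ih ht.2.2.2 h2 (RowInsert.le_of_some_some ht.2.1 h h1 hyx)
      omega

/-- The row bumping lemma. -/
theorem lt_iff {i j : ℕ} {t t' t'' : List (List α)} {x y : α} (ht : IsTableau t)
    (h : Inserts i t y t') (h' : Inserts j t' x t'') : i < j ↔ x < y :=
  ⟨fun hij => by
    by_contra hxy
    exact absurd hij (le_of_le ht h h' (not_lt.1 hxy)).not_gt, lt_of_lt ht h h'⟩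

end Inserts

end Insertion

/-! ### The Pieri rule in the odd plactic ring -/

namespace OddPlactic

theorem letter_knuth₁ {n : ℕ} {x y z : Fin n} (hxy : x < y) (hyz : y ≤ z) :
    (letter y * letter z * letter x : OddPlactic n) = -(letter y * letter x * letter z) := by
  have h := RingQuot.mkRingHom_rel (OddPlacticRel.knuth₁ x y z hxy hyz)
  simp only [map_mul, map_neg] at h
  exact h

theorem letter_knuth₂ {n : ℕ} {x y z : Fin n} (hxy : x ≤ y) (hyz : y < z) :
    (letter x * letter z * letter y : OddPlactic n) = -(letter z * letter x * letter y) := by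
  have h := RingQuot.mkRingHom_rel (OddPlacticRel.knuth₂ x y z hxy hyz)
  simp only [map_mul, map_neg] at h
  exact h

@[simp] theorem word_nil {n : ℕ} : word ([] : List (Fin n)) = 1 := rfl

@[simp] theorem word_cons {n : ℕ} (i : Fin n) (w : List (Fin n)) :
    word (i :: w) = letter i * word w := by simp [word]

theorem word_append {n : ℕ} (v w : List (Fin n)) : word (v ++ w) = word v * word w := by
  simp [word]

/-- A smaller letter moves to the left through a row, up to its first letter. -/
theorem word_cons_mul_letter {n : ℕ} {a x : Fin n} {r : List (Fin n)}
    (hr : (a :: r).Pairwise (· ≤ ·)) (hx : x < a) :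
    word (a :: r) * letter x = (-1) ^ r.length * (letter a * letter x * word r) := by
  induction r generalizing a with
  | nil => simp
  | cons b r ih =>
    have hab : a ≤ b := (List.pairwise_cons.1 hr).1 b (by simp)
    rw [word_cons, mul_assoc, ih (List.pairwise_cons.1 hr).2 (hx.trans_le hab), List.length_cons,
      pow_succ, ← mul_assoc, ← ((Commute.neg_one_left (letter a)).pow_left _).eq, mul_assoc,
      ← mul_assoc (letter a), ← mul_assoc (letter a), letter_knuth₁ hx hab, word_cons]
    noncomm_ring

end OddPlactic

namespace RowInsert

open OddPlactic

/-- The letter is just appended, so no Knuth relation and no sign enters. -/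
theorem word_none {n : ℕ} {r r' : List (Fin n)} {x : Fin n} (h : RowInsert r x none r') :
    word r * letter x = word r' := by
  generalize hp : (none : Option (Fin n)) = p at h
  induction h with
  | nil => simp
  | here => cases hp
  | there _ _ ih => rw [word_cons, word_cons, mul_assoc, ih hp]

/-- The letter `x` moves left to its place by relations of the first kind, then `y` moves left out
of the row by relations of the second kind. That is `r.length - 1` signs wherever the bump occurs;
the exponent `r.length + 1` has the same parity. -/
theorem word_some {n : ℕ} {r r' : List (Fin n)} {x y : Fin n} (h : RowInsert r x (some y) r')
    (hr : r.Pairwise (· ≤ ·)) :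
    word r * letter x = (-1) ^ (r.length + 1) * (letter y * word r') := by
  generalize hp : some y = p at h
  induction h with
  | nil => cases hp
  | here h =>
    cases hp
    rw [word_cons_mul_letter hr h, List.length_cons, word_cons, pow_succ, pow_succ]
    noncomm_ring
  | @there a x o r r' h1 h2 ih =>
    subst hp
    rw [word_cons, mul_assoc, ih (List.pairwise_cons.1 hr).2 rfl]
    obtain ⟨b, s, rfl⟩ := List.exists_cons_of_ne_nil (List.ne_nil_of_mem h2.mem_self)
    have hab : a ≤ b := by
      rcases h2.mem_of_mem (b := b) (by simp) with rfl | hb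
      · exact h1
      · exact (List.pairwise_cons.1 hr).1 b hb
    have hby : b < y := by
      have hs := h2.pairwise (List.pairwise_cons.1 hr).2
      refine lt_of_le_of_lt ?_ h2.lt_some
      rcases List.mem_cons.1 h2.mem_self with h | h
      · exact h.ge
      · exact (List.pairwise_cons.1 hs).1 _ h
    rw [← mul_assoc, ← ((Commute.neg_one_left (letter a)).pow_left _).eq, mul_assoc, word_cons,
      ← mul_assoc (letter y), ← mul_assoc (letter a), ← mul_assoc (letter a),
      letter_knuth₂ hab hby, List.length_cons, word_cons, word_cons, pow_succ _ (r.length + 1)]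
    noncomm_ring

end RowInsert

namespace OddPlactic

/-- The class of the row word of a tableau given by its list of rows. -/
noncomputable def tableauWord {n : ℕ} : List (List (Fin n)) → OddPlactic n
  | [] => 1
  | r :: t => tableauWord t * word r

/-- The exponent of the sign of an insertion ending in row `i` of a tableau of given shape. -/
def insertSign : ℕ → List ℕ → ℕ
  | 0, _ => 0
  | _ + 1, [] => 0
  | i + 1, a :: l => (a + 1) + insertSign i l

/-- Each row that bumps contributes a sign depending only on its length. The total sign is therefore
constant over all insertions from a given shape ending in a given row, which is why whole tableau
sums stay together. -/
theorem tableauWord_mul_letter {n i : ℕ} {t t' : List (List (Fin n))} {x : Fin n}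
    (ht : IsTableau t) (h : Inserts i t x t') :
    tableauWord t * letter x
      = (-1) ^ insertSign i (t.map List.length) * tableauWord t' := by
  induction h with
  | nil => simp [tableauWord, insertSign]
  | append h => simp [tableauWord, insertSign, mul_assoc, h.word_none]
  | @bump r r' t t' x y i h _ ih =>
    rw [tableauWord, mul_assoc, h.word_some ht.2.1, ← mul_assoc,
      ← ((Commute.neg_one_left (tableauWord t)).pow_left _).eq, mul_assoc,
      ← mul_assoc (tableauWord t), ih ht.2.2.2, List.map_cons, insertSign, tableauWord, pow_add _ (r.length + 1)]
    simp only [mul_assoc]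

theorem finite_setOf_map_length {α : Type*} [Finite α] (l : List ℕ) :
    {t : List (List α) | t.map List.length = l}.Finite := by
  induction l with
  | nil => simp
  | cons a l ih =>
    refine ((List.finite_length_eq α a).image2 List.cons ih).subset ?_
    rintro t ht
    cases t with
    | nil => simp at ht
    | cons r t =>
      simp only [Set.mem_ofPred_eq, List.map_cons, List.cons.injEq] at ht
      exact ⟨r, ht.1, t, ht.2, rfl⟩

/-- The tableaux of a given shape with entries in the `n`-letter alphabet. -/
noncomputable def tableaux (n : ℕ) (l : List ℕ) : Finset (List (List (Fin n))) :=
  ((finite_setOf_map_length l).subset fun _ h => h.2 :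
    {t : List (List (Fin n)) | IsTableau t ∧ t.map List.length = l}.Finite).toFinset

theorem mem_tableaux {n : ℕ} {l : List ℕ} {t : List (List (Fin n))} :
    t ∈ tableaux n l ↔ IsTableau t ∧ t.map List.length = l := by
  simp [tableaux]

/-- The sum of all tableaux of a given shape. -/
noncomputable def tableauSum (n : ℕ) (l : List ℕ) : OddPlactic n :=
  ∑ t ∈ tableaux n l, tableauWord t

/-- The span of the sums of all tableaux of a given shape. -/
noncomputable def tableauSpan (n : ℕ) : Submodule ℤ (OddPlactic n) :=
  Submodule.span ℤ (Set.range (tableauSum n))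

theorem tableauSum_mem (n : ℕ) (l : List ℕ) : tableauSum n l ∈ tableauSpan n :=
  Submodule.subset_span ⟨l, rfl⟩

theorem tableauSum_nil (n : ℕ) : tableauSum n [] = 1 := by
  have : tableaux n [] = {[]} := by
    ext t
    rw [mem_tableaux, Finset.mem_singleton, List.map_eq_nil_iff]
    exact ⟨fun h => h.2, fun h => ⟨h ▸ trivial, h⟩⟩
  simp [tableauSum, this, tableauWord]

theorem neg_one_pow_mul_mem {R : Type*} [Ring R] (V : Submodule ℤ R) (k : ℕ) {f : R} :
    (-1) ^ k * f ∈ V ↔ f ∈ V := by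
  rcases neg_one_pow_eq_or R k with h | h <;> simp [h]

/-- The row in which the insertion of a letter ends. -/
noncomputable def insertRow {n : ℕ} (t : List (List (Fin n))) (x : Fin n) : ℕ :=
  (Inserts.exists_inserts t x).choose

/-- The result of the insertion of a letter. -/
noncomputable def insertResult {n : ℕ} (t : List (List (Fin n))) (x : Fin n) :
    List (List (Fin n)) :=
  (Inserts.exists_inserts t x).choose_spec.choose

theorem inserts_insertResult {n : ℕ} (t : List (List (Fin n))) (x : Fin n) :
    Inserts (insertRow t x) t x (insertResult t x) :=
  (Inserts.exists_inserts t x).choose_spec.choose_spec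

/-- Pairs of a tableau and a letter correspond to tableaux with one more box. -/
theorem sum_insertResult {n : ℕ} {M : Type*} [AddCommMonoid M] {l : List ℕ}
    (hl : IsPartitionList l) {j : ℕ} (hj : j ≤ l.length) (G : List (List (Fin n)) → M) :
    ∑ p ∈ tableaux n l ×ˢ Finset.univ with insertRow p.1 p.2 = j, G (insertResult p.1 p.2)
      = ∑ t ∈ tableaux n (addBox j l), G t := by
  refine Finset.sum_bij (fun p _ => insertResult p.1 p.2) ?_ ?_ ?_ (fun _ _ => rfl)
  · rintro ⟨t, x⟩ hp
    simp only [Finset.mem_filter, Finset.mem_product, mem_tableaux] at hp ⊢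
    have h := inserts_insertResult t x
    exact ⟨h.isTableau hp.1.1.1, by rw [h.map_length, hp.2, hp.1.1.2]⟩
  · rintro ⟨t, x⟩ hp ⟨s, z⟩ hq heq
    simp only [Finset.mem_filter, Finset.mem_product, mem_tableaux] at hp hq heq
    have h1 := inserts_insertResult t x
    have h2 := inserts_insertResult s z
    rw [hp.2] at h1
    rw [hq.2, ← heq] at h2
    simpa using h1.injective hp.1.1.1 hq.1.1.1 h2
  · intro t' ht'
    rw [mem_tableaux] at ht'
    obtain ⟨t, x, h1, h2, h3⟩ := Inserts.exists_reverse hl hj ht'.1 ht'.2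
    obtain ⟨h4, h5⟩ := (inserts_insertResult t x).unique h3
    exact ⟨(t, x), by simp [mem_tableaux, h1, h2, h4], h5⟩

/-- Groups the pairs `(t, x)` by the row `j` where insertion ends. In one group the sign is constant
and insertion is a bijection onto the tableaux with a box added in row `j`. The sum can thus be
rewritten over the new tableaux, provided the remaining factor is a function `G` of the result
alone. -/
theorem sum_tableauWord_mul_mem_of_forall {n m : ℕ}
    (h : ∀ j, ∃ G : List (List (Fin n)) → OddPlactic n,
      (∀ t x, IsTableau t → insertRow t x = j → colSum n m x = G (insertResult t x)) ∧
        ∀ l, ∑ t ∈ tableaux n l, tableauWord t * G t ∈ tableauSpan n) (l : List ℕ) (i : ℕ) :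
    ∑ t ∈ tableaux n l, ∑ x with i ≤ insertRow t x,
      tableauWord t * (letter x * colSum n m x) ∈ tableauSpan n := by
  by_cases hl : IsPartitionList l
  swap
  · have : tableaux n l = ∅ := by
      refine Finset.eq_empty_of_forall_notMem fun t ht => hl ?_
      obtain ⟨h1, h2⟩ := mem_tableaux.1 ht
      exact h2 ▸ h1.isPartitionList
    simp [this]
  have hmaps : ∀ p ∈ tableaux n l ×ˢ (Finset.univ : Finset (Fin n)),
      insertRow p.1 p.2 ∈ Finset.range (l.length + 1) := by
    intro p hp
    obtain ⟨-, h2⟩ := mem_tableaux.1 (Finset.mem_product.1 hp).1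
    have := (inserts_insertResult p.1 p.2).le_length
    rw [Finset.mem_range, ← h2, List.length_map]
    omega
  simp only [Finset.sum_filter]
  rw [← Finset.sum_product', ← Finset.sum_fiberwise_of_maps_to hmaps]
  refine Submodule.sum_mem _ fun j hj => ?_
  obtain ⟨G, hG, hmem⟩ := h j
  have hterm : ∀ p ∈ (tableaux n l ×ˢ Finset.univ).filter fun p => insertRow p.1 p.2 = j,
      (if i ≤ insertRow p.1 p.2 then tableauWord p.1 * (letter p.2 * colSum n m p.2) else 0)
        = if i ≤ j then (-1) ^ insertSign j l *
            (tableauWord (insertResult p.1 p.2) * G (insertResult p.1 p.2)) else 0 := by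
    intro p hp
    obtain ⟨hp1, hp2⟩ := Finset.mem_filter.1 hp
    obtain ⟨h1, h2⟩ := mem_tableaux.1 (Finset.mem_product.1 hp1).1
    have h3 := tableauWord_mul_letter h1 (inserts_insertResult p.1 p.2)
    rw [hp2, h2] at h3
    rw [hp2, ← mul_assoc, h3, hG _ _ h1 hp2, mul_assoc]
  rw [Finset.sum_congr rfl hterm]
  split_ifs
  · rw [← Finset.mul_sum, neg_one_pow_mul_mem,
      sum_insertResult hl (by simpa [Nat.lt_succ_iff] using hj) fun t => tableauWord t * G t]
    exact hmem _
  · simp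

/-- The lower bound `i` on the final row is what makes the induction close. After inserting `x` with
final row `j`, the next letter `y` of a decreasing word satisfies `y < x` exactly when its insertion
ends in row `j + 1` or below, a condition that no longer mentions `x`. -/
theorem sum_tableauWord_mul_mem {n : ℕ} (m : ℕ) (l : List ℕ) (i : ℕ) :
    ∑ t ∈ tableaux n l, ∑ x with i ≤ insertRow t x,
      tableauWord t * (letter x * colSum n m x) ∈ tableauSpan n := by
  induction m generalizing l i with
  | zero =>
    refine sum_tableauWord_mul_mem_of_forall (fun j => ⟨fun _ => 1, by simp [colSum], ?_⟩) l i
    exact fun l => by simpa [tableauSum] using tableauSum_mem n l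
  | succ m ih =>
    refine sum_tableauWord_mul_mem_of_forall (fun j =>
      ⟨fun t => ∑ y with j + 1 ≤ insertRow t y, letter y * colSum n m y, ?_, ?_⟩) l i
    · intro t x ht hj
      rw [colSum_succ]
      congr 1
      ext y
      have := Inserts.lt_iff ht (inserts_insertResult t x)
        (inserts_insertResult (insertResult t x) y)
      rw [hj] at this
      simpa [Nat.succ_le_iff] using this.symm
    · simpa only [Finset.mul_sum] using fun l => ih l (j + 1)

theorem mul_colSum_mem {n : ℕ} {f : OddPlactic n} (hf : f ∈ tableauSpan n) (m : ℕ) :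
    f * colSum n m n ∈ tableauSpan n := by
  induction hf using Submodule.span_induction with
  | zero => simp
  | add f g _ _ hf hg => rw [add_mul]; exact add_mem hf hg
  | smul r f _ hf => rw [smul_mul_assoc]; exact Submodule.smul_mem _ r hf
  | mem f hf =>
    obtain ⟨l, rfl⟩ := hf
    cases m with
    | zero => simpa [colSum] using tableauSum_mem n l
    | succ m =>
      have := sum_tableauWord_mul_mem (n := n) m l 0
      simp only [Nat.zero_le, Finset.filter_true, ← Finset.mul_sum, ← Finset.sum_mul] at this
      simpa [tableauSum, colSum_succ] using this

theorem elementaryAlgebra_le (n : ℕ) :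
    Subalgebra.toSubmodule (elementaryAlgebra n) ≤ tableauSpan n := by
  have key (f) (hf : f ∈ elementaryAlgebra n) : ∀ g ∈ tableauSpan n, g * f ∈ tableauSpan n := by
    induction hf using Algebra.adjoin_induction with
    | mem f hf =>
      obtain ⟨m, rfl⟩ := hf
      exact fun g hg => mul_colSum_mem hg m
    | algebraMap r =>
      intro g hg
      rw [← Algebra.commutes, ← Algebra.smul_def]
      exact Submodule.smul_mem _ r hg
    | add f h _ _ hf hh => intro g hg; rw [mul_add]; exact add_mem (hf g hg) (hh g hg)
    | mul f h _ _ hf hh => intro g hg; rw [← mul_assoc]; exact hh _ (hf g hg)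
  intro f hf
  simpa [tableauSum_nil] using key f hf _ (tableauSum_mem n [])

end OddPlactic

/-! ### Tableaux as lists of rows and as fillings of Young diagrams -/

section

variable {α : Type*} [LinearOrder α]

theorem RowDom.getElem_lt {r s : List α} (h : RowDom r s) (j : ℕ) (hr : j < r.length)
    (hs : j < s.length) : r[j] < s[j] := by
  induction h generalizing j with
  | nil => simp at hs
  | cons h _ ih =>
    cases j with
    | zero => exact h
    | succ j => exact ih j (by simpa using hr) (by simpa using hs)

theorem RowDom.of_getElem_lt {r s : List α} (hl : s.length ≤ r.length)
    (h : ∀ j (hs : j < s.length), r[j] < s[j]) : RowDom r s := by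
  induction s generalizing r with
  | nil => exact .nil _
  | cons b s ih =>
    cases r with
    | nil => simp at hl
    | cons a r =>
      exact .cons (h 0 (by simp)) (ih (by simpa using hl) fun j hj => h (j + 1) (by simpa using hj))

theorem IsTableau.pairwise_getElem? {t : List (List α)} (ht : IsTableau t) (i : ℕ) :
    (t[i]?.getD []).Pairwise (· ≤ ·) := by
  induction t generalizing i with
  | nil => simp
  | cons r t ih =>
    cases i with
    | zero => exact ht.2.1
    | succ i => exact ih ht.2.2.2 i

theorem IsTableau.rowDom_getElem? {t : List (List α)} (ht : IsTableau t) (i : ℕ) :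
    RowDom (t[i]?.getD []) (t[i + 1]?.getD []) := by
  induction t generalizing i with
  | nil => exact .nil _
  | cons r t ih =>
    cases i with
    | zero => cases t <;> exact ht.2.2.1
    | succ i => exact ih ht.2.2.2 i

theorem isTableau_map_range' {row : ℕ → List α} {m k : ℕ}
    (hne : ∀ i < k + m, row i ≠ []) (hnil : row (k + m) = [])
    (hrow : ∀ i, (row i).Pairwise (· ≤ ·)) (hdom : ∀ i, RowDom (row i) (row (i + 1))) :
    IsTableau ((List.range' k m).map row) := by
  induction m generalizing k with
  | zero => trivial
  | succ m ih =>
    rw [List.range'_succ, List.map_cons]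
    refine ⟨hne k (by omega), hrow k, ?_, ih (by convert hne using 3; omega) (by
      rw [← hnil]; congr 1; omega)⟩
    cases m with
    | zero => exact .nil _
    | succ m => exact hdom k

end

namespace BoundedSSYT

/-- The row of index `i` of a tableau. -/
def row {n : ℕ} {μ : YoungDiagram} (T : BoundedSSYT n μ) (i : ℕ) : List (Fin n) :=
  List.ofFn fun j : Fin (μ.rowLen i) =>
    (⟨T.1 i j, T.2 i j (YoungDiagram.mem_iff_lt_rowLen.2 j.2)⟩ : Fin n)

/-- The list of rows of a tableau. -/
def rows {n : ℕ} {μ : YoungDiagram} (T : BoundedSSYT n μ) : List (List (Fin n)) :=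
  (List.range (μ.colLen 0)).map T.row

theorem length_row {n : ℕ} {μ : YoungDiagram} (T : BoundedSSYT n μ) (i : ℕ) :
    (T.row i).length = μ.rowLen i := by simp [row]

theorem rowLen_pos_iff {μ : YoungDiagram} {i : ℕ} : 0 < μ.rowLen i ↔ i < μ.colLen 0 := by
  rw [← YoungDiagram.mem_iff_lt_rowLen, YoungDiagram.mem_iff_lt_colLen]

theorem rows_mem {n : ℕ} {μ : YoungDiagram} (T : BoundedSSYT n μ) :
    T.rows ∈ OddPlactic.tableaux n μ.rowLens := by
  rw [OddPlactic.mem_tableaux]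
  constructor
  · rw [rows, List.range_eq_range']
    refine isTableau_map_range' ?_ ?_ ?_ ?_
    · intro i hi
      rw [← List.length_pos_iff, length_row, rowLen_pos_iff]
      omega
    · rw [← List.length_eq_zero_iff, length_row, ← Nat.le_zero, ← not_lt, rowLen_pos_iff]
      omega
    · intro i
      rw [row, List.pairwise_ofFn]
      intro j k hjk
      exact T.1.row_weak hjk (YoungDiagram.mem_iff_lt_rowLen.2 k.2)
    · intro i
      refine RowDom.of_getElem_lt ?_ fun j hj => ?_
      · rw [length_row, length_row]
        exact μ.rowLen_anti _ _ (Nat.le_succ i)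
      · rw [length_row] at hj
        simp only [row, List.getElem_ofFn]
        exact T.1.col_strict (Nat.lt_succ_self i) (YoungDiagram.mem_iff_lt_rowLen.2 hj)
  · rw [rows, List.map_map, YoungDiagram.rowLens]
    exact List.map_congr_left fun i _ => T.length_row i

theorem rows_injective {n : ℕ} {μ : YoungDiagram} :
    Function.Injective (rows : BoundedSSYT n μ → List (List (Fin n))) := by
  intro T U h
  apply Subtype.ext
  ext i j
  by_cases hc : (i, j) ∈ μ
  · have hi : i < μ.colLen 0 := rowLen_pos_iff.1
      ((Nat.zero_le j).trans_lt (YoungDiagram.mem_iff_lt_rowLen.1 hc))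
    have h1 : T.row i = U.row i := List.map_inj_left.1 h i (List.mem_range.2 hi)
    have h2 := congrFun (List.ofFn_injective h1) ⟨j, YoungDiagram.mem_iff_lt_rowLen.1 hc⟩
    simpa using h2
  · rw [T.1.zeros hc, U.1.zeros hc]

theorem exists_rows_eq {n : ℕ} {μ : YoungDiagram} {t : List (List (Fin n))}
    (ht : t ∈ OddPlactic.tableaux n μ.rowLens) : ∃ T : BoundedSSYT n μ, T.rows = t := by
  obtain ⟨ht, hs⟩ := OddPlactic.mem_tableaux.1 ht
  have hlen : t.length = μ.colLen 0 := by simpa using congrArg List.length hs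
  have hrow (i : ℕ) : (t[i]?.getD []).length = μ.rowLen i := by
    by_cases hi : i < μ.colLen 0
    · have h1 : (t.map List.length)[i]? = μ.rowLens[i]? := by rw [hs]
      rw [List.getElem?_map, List.getElem?_eq_getElem (by omega),
        List.getElem?_eq_getElem (by simpa using hi), YoungDiagram.get_rowLens] at h1
      rw [List.getElem?_eq_getElem (by omega)]
      simpa using h1
    · rw [List.getElem?_eq_none (by omega)]
      have := mt rowLen_pos_iff.1 hi
      simp
      omega
  set e : ℕ → ℕ → ℕ := fun i j => ((t[i]?.getD [])[j]?).elim 0 Fin.val with he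
  have hget (i j : ℕ) (h : (i, j) ∈ μ) : e i j = ((t[i]?.getD [])[j]'(by
      rw [hrow]; exact YoungDiagram.mem_iff_lt_rowLen.1 h)).val := by
    rw [he]
    dsimp only
    rw [List.getElem?_eq_getElem]
    rfl
  refine ⟨⟨⟨e, ?_, ?_, ?_⟩, ?_⟩, ?_⟩
  · intro i j k hjk hk
    rw [hget i j (μ.up_left_mem le_rfl hjk.le hk), hget i k hk]
    exact List.pairwise_iff_getElem.1 (ht.pairwise_getElem? i) _ _ _ _ hjk
  · intro i k j hik hk
    induction k, hik using Nat.le_induction with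
    | base =>
      rw [hget _ _ (μ.up_left_mem (Nat.le_succ i) le_rfl hk), hget _ _ hk]
      exact (ht.rowDom_getElem? i).getElem_lt _ _ _
    | succ k _ ih =>
      have hk' := μ.up_left_mem (Nat.le_succ k) le_rfl hk
      refine (ih hk').trans ?_
      rw [hget _ _ hk', hget _ _ hk]
      exact (ht.rowDom_getElem? k).getElem_lt _ _ _
  · intro i j h
    rw [YoungDiagram.mem_iff_lt_rowLen] at h
    rw [he]
    dsimp only
    rw [List.getElem?_eq_none (by rw [hrow]; omega)]
    rfl
  · intro i j h
    exact (hget i j h).trans_lt (Fin.is_lt _)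
  · refine List.ext_getElem (by simp [rows, hlen]) fun i h1 h2 => ?_
    have hi : t[i]?.getD [] = t[i] := by rw [List.getElem?_eq_getElem h2]; rfl
    refine List.ext_getElem ?_ fun j h3 h4 => ?_
    · rw [← hi, hrow]
      simp only [rows, List.getElem_map, List.getElem_range]
      exact length_row _ i
    · ext
      simp only [rows, row, List.getElem_map, List.getElem_range, List.getElem_ofFn]
      refine (hget i j ?_).trans ?_
      · rw [YoungDiagram.mem_iff_lt_rowLen, ← hrow, hi]
        exact h4
      · simp only [hi]

end BoundedSSYT

/-! ### Tableau sums as odd plactic Schur elements -/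

namespace OddPlactic

theorem word_flatten_reverse {n : ℕ} (t : List (List (Fin n))) :
    word t.reverse.flatten = tableauWord t := by
  induction t with
  | nil => rfl
  | cons r t ih => simp [word_append, ih, tableauWord]

theorem sum_word_rowWord (n : ℕ) (μ : YoungDiagram) :
    ∑ T : BoundedSSYT n μ, word T.rowWord = tableauSum n μ.rowLens := by
  refine Finset.sum_bij (fun T _ => T.rows) (fun T _ => T.rows_mem)
    (fun T _ U _ h => BoundedSSYT.rows_injective h)
    (fun t ht => by simpa using BoundedSSYT.exists_rows_eq ht) fun T _ => ?_
  rw [← word_flatten_reverse, BoundedSSYT.rows, ← List.map_reverse]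
  rfl

theorem _root_.IsPartitionList.antitone {l : List ℕ} (hl : IsPartitionList l) :
    Antitone fun i : ℕ => l[i]?.getD 0 := by
  refine antitone_nat_of_succ_le fun i => ?_
  induction l generalizing i with
  | nil => simp
  | cons a l ih =>
    cases i with
    | zero =>
      cases l with
      | nil => simp
      | cons b l => simpa using hl.2.1
    | succ i => exact ih hl.2.2 i

theorem _root_.IsPartitionList.pos {l : List ℕ} (hl : IsPartitionList l) {a : ℕ} (ha : a ∈ l) :
    0 < a := by
  induction l with
  | nil => simp at ha
  | cons b l ih =>
    rcases List.mem_cons.1 ha with rfl | ha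
    · exact hl.1
    · exact ih hl.2.2 ha

theorem _root_.IsPartitionList.exists_rowLens {l : List ℕ} (hl : IsPartitionList l) :
    ∃ μ : YoungDiagram, μ.rowLens = l := by
  refine ⟨YoungDiagram.ofRowLens l ?_, YoungDiagram.rowLens_ofRowLens_eq_self fun a => hl.pos⟩
  rw [List.sortedGE_iff_pairwise, List.pairwise_iff_getElem]
  intro i j hi hj hij
  have := hl.antitone hij.le
  simpa [hi, hj] using this

theorem tableauSum_eq_zero {n : ℕ} {l : List ℕ} (hl : ¬IsPartitionList l) :
    tableauSum n l = 0 := by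
  have : tableaux n l = ∅ := by
    refine Finset.eq_empty_of_forall_notMem fun t ht => hl ?_
    obtain ⟨h1, h2⟩ := mem_tableaux.1 ht
    exact h2 ▸ h1.isPartitionList
  simp [tableauSum, this]

/-- Signs do not change a span, and lists that are not partitions contribute zero because no tableau
has such a shape. -/
theorem span_oddPlacticSchur (n : ℕ) :
    Submodule.span ℤ (Set.range fun μ : YoungDiagram => oddPlacticSchur n μ)
      = tableauSpan n := by
  apply le_antisymm
  · refine Submodule.span_le.2 ?_
    rintro _ ⟨μ, rfl⟩
    dsimp only
    rw [SetLike.mem_coe, oddPlacticSchur, sum_word_rowWord, neg_one_pow_mul_mem]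
    exact tableauSum_mem n _
  · refine Submodule.span_le.2 ?_
    rintro _ ⟨l, rfl⟩
    by_cases hl : IsPartitionList l
    · obtain ⟨μ, rfl⟩ := hl.exists_rowLens
      rw [SetLike.mem_coe, ← neg_one_pow_mul_mem _ (directNorth μ + north μ), ← sum_word_rowWord]
      exact Submodule.subset_span ⟨μ, rfl⟩
    · rw [tableauSum_eq_zero hl]
      exact zero_mem _

end OddPlactic

/-! ### Leading exponents of sums of tableaux -/

namespace OddPlactic

open OPol

theorem toOPol_word {n : ℕ} (w : List (Fin n)) :
    toOPol n (word w) = mono (content w) ∨ toOPol n (word w) = -mono (content w) := by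
  have : toOPol n (word w) = xword w ∨ toOPol n (word w) = -xword w := by
    induction w with
    | nil => simp
    | cons i w ih =>
      rw [word_cons, map_mul, toOPol_letter, xword_cons]
      rcases ih with h | h <;> rcases xt_eq i with h' | h' <;> simp [h, h']
  rcases this with h | h <;> rcases xword_eq_mono w with h' | h' <;> simp [h, h']

theorem toOPol_tableauWord {n : ℕ} (t : List (List (Fin n))) :
    toOPol n (tableauWord t) = mono (content t.flatten) ∨
      toOPol n (tableauWord t) = -mono (content t.flatten) := by
  have h : content t.reverse.flatten = content t.flatten := by
    rw [content, content, Multiset.coe_eq_coe.2 (List.reverse_perm t).flatten]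
  rw [← word_flatten_reverse, ← h]
  exact toOPol_word _

theorem isLead_mono {n : ℕ} (a : Fin n →₀ ℕ) : IsLead (mono a) a := by
  refine ⟨by simp [coeff_mono], fun b hb => ?_⟩
  have : a = b := by by_contra h; simp [coeff_mono, h] at hb
  rw [this]

theorem isLead_toOPol_tableauWord {n : ℕ} (t : List (List (Fin n))) :
    IsLead (toOPol n (tableauWord t)) (content t.flatten) := by
  rcases toOPol_tableauWord t with h | h <;> rw [h]
  · exact isLead_mono _
  · exact (isLead_mono _).neg

/-- The exponent vector with entries `l` in the variables from `k` on. -/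
noncomputable def shapeExp (n k : ℕ) (l : List ℕ) : Fin n →₀ ℕ :=
  Finsupp.equivFunOnFinite.symm fun i => if k ≤ i then l[(i : ℕ) - k]?.getD 0 else 0

theorem shapeExp_apply (n k : ℕ) (l : List ℕ) (i : Fin n) :
    shapeExp n k l i = if k ≤ i then l[(i : ℕ) - k]?.getD 0 else 0 := rfl

theorem shapeExp_cons {n k : ℕ} (hk : k < n) (a : ℕ) (l : List ℕ) :
    shapeExp n k (a :: l) = Finsupp.single ⟨k, hk⟩ a + shapeExp n (k + 1) l := by
  ext i
  simp only [Finsupp.add_apply, shapeExp_apply, Finsupp.single_apply, Fin.ext_iff]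
  rcases lt_trichotomy k (i : ℕ) with h | h | h
  · have h1 : (i : ℕ) - k = (i - (k + 1)) + 1 := by omega
    rw [if_pos h.le, if_neg h.ne, if_pos (Nat.succ_le_of_lt h), h1, zero_add,
      List.getElem?_cons_succ]
  · simp [h]
  · rw [if_neg (by omega), if_neg (by omega), if_neg (by omega)]

/-- The row of index `i` consists of letters `k + i` only. -/
def IsSuper {n : ℕ} : ℕ → List (List (Fin n)) → Prop
  | _, [] => True
  | k, r :: t => (∀ a ∈ r, (a : ℕ) = k) ∧ IsSuper (k + 1) t

theorem IsSuper.eq {n k : ℕ} {t s : List (List (Fin n))} (ht : IsSuper k t) (hs : IsSuper k s)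
    (h : t.map List.length = s.map List.length) : t = s := by
  induction t generalizing s k with
  | nil => simpa [eq_comm] using h
  | cons r t ih =>
    cases s with
    | nil => simp at h
    | cons q s =>
      simp only [List.map_cons, List.cons.injEq] at h
      rw [ih ht.2 hs.2 h.2]
      congr 1
      refine List.ext_getElem h.1 fun j h1 h2 => Fin.ext ?_
      rw [ht.1 _ (List.getElem_mem h1), hs.1 _ (List.getElem_mem h2)]

theorem exists_isSuper {n k : ℕ} {l : List ℕ} (hl : IsPartitionList l) (hk : k + l.length ≤ n) :
    ∃ t : List (List (Fin n)), IsTableau t ∧ t.map List.length = l ∧ IsSuper k t := by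
  induction l generalizing k with
  | nil => exact ⟨[], trivial, rfl, trivial⟩
  | cons a l ih =>
    rw [List.length_cons] at hk
    obtain ⟨t, h1, h2, h3⟩ := ih hl.2.2 (k := k + 1) (by omega)
    refine ⟨List.replicate a ⟨k, by omega⟩ :: t, ⟨?_, ?_, ?_, h1⟩, by simp [h2], ?_, h3⟩
    · simpa using hl.1.ne'
    · simp [List.pairwise_replicate]
    · refine RowDom.of_getElem_lt ?_ fun j hj => ?_
      · rw [← headD_map_length, h2]
        simpa using hl.2.1
      · cases t with
        | nil => simp at hj
        | cons r t =>
          rw [List.getElem_replicate, Fin.lt_def]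
          have := h3.1 _ (List.getElem_mem hj)
          simp only [List.headD_cons] at this ⊢
          omega
    · intro b hb
      rw [List.eq_of_mem_replicate hb]

theorem _root_.RowDom.succ_le {n k : ℕ} {r s : List (Fin n)} (h : RowDom r s)
    (hr : ∀ a ∈ r, k ≤ (a : ℕ)) : ∀ b ∈ s, k + 1 ≤ (b : ℕ) := by
  intro b hb
  obtain ⟨j, hj, rfl⟩ := List.mem_iff_getElem.1 hb
  have hj' := hj.trans_le h.length_le
  have h1 := hr _ (List.getElem_mem hj')
  have h2 : (r[j] : ℕ) < s[j] := h.getElem_lt j hj' hj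
  omega

theorem le_of_mem_flatten {n k : ℕ} {t : List (List (Fin n))} (ht : IsTableau t)
    (hk : ∀ a ∈ t.headD [], k ≤ (a : ℕ)) : ∀ a ∈ t.flatten, k ≤ (a : ℕ) := by
  induction t generalizing k with
  | nil => simp
  | cons r t ih =>
    intro a ha
    rw [List.flatten_cons, List.mem_append] at ha
    rcases ha with ha | ha
    · exact hk a ha
    · exact (Nat.le_succ k).trans (ih ht.2.2.2 (ht.2.2.1.succ_le hk) a ha)

theorem length_le_of_isTableau {n k : ℕ} (hkn : k ≤ n) {t : List (List (Fin n))}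
    (ht : IsTableau t) (hk : ∀ a ∈ t.headD [], k ≤ (a : ℕ)) : k + t.length ≤ n := by
  induction t generalizing k with
  | nil => simpa using hkn
  | cons r t ih =>
    obtain ⟨a, ha⟩ := List.exists_mem_of_ne_nil r ht.1
    have h1 : k ≤ (a : ℕ) := hk a ha
    have h2 := a.2
    have := ih (k := k + 1) (by omega) ht.2.2.2 (ht.2.2.1.succ_le hk)
    rw [List.length_cons]
    omega

theorem content_eq_single {n : ℕ} {r : List (Fin n)} {i : Fin n} (h : ∀ a ∈ r, a = i) :
    content r = Finsupp.single i r.length := by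
  ext j
  rw [content_apply, List.eq_replicate_of_mem h, List.count_replicate, Finsupp.single_apply]
  simp

theorem content_eq_shapeExp {n k : ℕ} {t : List (List (Fin n))} (ht : IsTableau t)
    (hs : IsSuper k t) : content t.flatten = shapeExp n k (t.map List.length) := by
  induction t generalizing k with
  | nil => ext i; simp [shapeExp_apply, content_apply]
  | cons r t ih =>
    obtain ⟨a, ha⟩ := List.exists_mem_of_ne_nil r ht.1
    have hk : k < n := hs.1 a ha ▸ a.2
    rw [List.flatten_cons, content_append, List.map_cons, shapeExp_cons hk, ih ht.2.2.2 hs.2,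
      content_eq_single (i := ⟨k, hk⟩) fun b hb => Fin.ext (hs.1 b hb)]

/-- The letter `k` can occur only in the top row, since all lower entries are at least `k + 1`. If
some top entry differs from `k`, the exponent at `k` is already too small; otherwise the comparison
passes to the remaining rows. -/
theorem isSuper_or_content_lt {n k : ℕ} {t : List (List (Fin n))} (ht : IsTableau t)
    (hk : ∀ a ∈ t.headD [], k ≤ (a : ℕ)) :
    IsSuper k t ∨ toLex (content t.flatten) < toLex (shapeExp n k (t.map List.length)) := by
  induction t generalizing k with
  | nil => exact Or.inl trivial
  | cons r t ih =>
    obtain ⟨a, ha⟩ := List.exists_mem_of_ne_nil r ht.1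
    have hkn : k < n := (hk a ha).trans_lt a.2
    have hmem := le_of_mem_flatten ht.2.2.2 (ht.2.2.1.succ_le hk)
    rw [List.flatten_cons, content_append, List.map_cons, shapeExp_cons hkn]
    by_cases h : ∀ a ∈ r, (a : ℕ) = k
    · rcases ih ht.2.2.2 (ht.2.2.1.succ_le hk) with h1 | h1
      · exact Or.inl ⟨h, h1⟩
      · right
        rw [content_eq_single (i := ⟨k, hkn⟩) fun b hb => Fin.ext (h b hb), toLex_add, toLex_add]
        exact add_lt_add_right h1 _
    · right
      have htail (j : Fin n) (hj : (j : ℕ) ≤ k) : t.flatten.count j = 0 := by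
        rw [List.count_eq_zero]
        intro hjm
        have := hmem j hjm
        omega
      refine Finsupp.Lex.lt_iff.2 ⟨⟨k, hkn⟩, fun j hj => ?_, ?_⟩
      · have hj' : (j : ℕ) < k := hj
        have : r.count j = 0 := by
          rw [List.count_eq_zero]
          intro hjm
          have : k ≤ (j : ℕ) := hk j hjm
          omega
        simp [content_apply, htail j hj'.le, this, shapeExp_apply,
          hj.ne', show ¬k + 1 ≤ (j : ℕ) by omega]
      · push Not at h
        obtain ⟨b, hb, hbk⟩ := h
        have : r.count ⟨k, hkn⟩ < r.length := by
          refine lt_of_le_of_ne List.count_le_length fun h => hbk ?_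
          rw [← List.count_eq_length.1 h b hb]
        simpa [content_apply, htail ⟨k, hkn⟩ le_rfl, shapeExp_apply] using this

/-- The superstandard tableau is the only one attaining the exponent of the shape, so its term
cannot cancel. -/
theorem isLead_toOPol_tableauSum {n : ℕ} {l : List ℕ} (hl : IsPartitionList l)
    (hn : l.length ≤ n) : IsLead (toOPol n (tableauSum n l)) (shapeExp n 0 l) := by
  obtain ⟨t, h1, h2, h3⟩ := exists_isSuper (n := n) (k := 0) hl (by omega)
  have ht : t ∈ tableaux n l := mem_tableaux.2 ⟨h1, h2⟩
  rw [tableauSum, ← Finset.add_sum_erase _ _ ht, map_add, map_sum]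
  refine IsLead.add_isBelow ?_ (IsBelow.sum fun u hu => ?_)
  · rw [← h2, ← content_eq_shapeExp h1 h3]
    exact isLead_toOPol_tableauWord t
  · obtain ⟨hne, hu⟩ := Finset.mem_erase.1 hu
    obtain ⟨h4, h5⟩ := mem_tableaux.1 hu
    refine (isLead_toOPol_tableauWord u).isBelow ?_
    rcases isSuper_or_content_lt (k := 0) h4 (by simp) with h | h
    · exact absurd (h.eq h3 (h5.trans h2.symm)) hne
    · rwa [h5] at h

theorem _root_.IsPartitionList.ext {l l' : List ℕ} (hl : IsPartitionList l)
    (hl' : IsPartitionList l') (h : ∀ i : ℕ, l[i]?.getD 0 = l'[i]?.getD 0) : l = l' := by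
  induction l generalizing l' with
  | nil =>
    cases l' with
    | nil => rfl
    | cons b l' => exact absurd (h 0) (by simpa using hl'.1.ne)
  | cons a l ih =>
    cases l' with
    | nil => exact absurd (h 0) (by simpa using hl.1.ne')
    | cons b l' =>
      have h0 : a = b := by simpa using h 0
      rw [h0, ih hl.2.2 hl'.2.2 fun i => by simpa using h (i + 1)]

theorem shapeExp_injective {n : ℕ} {l l' : List ℕ} (hl : IsPartitionList l)
    (hl' : IsPartitionList l') (hn : l.length ≤ n) (hn' : l'.length ≤ n)
    (h : shapeExp n 0 l = shapeExp n 0 l') : l = l' := by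
  refine hl.ext hl' fun i => ?_
  by_cases hi : i < n
  · simpa [shapeExp_apply] using DFunLike.congr_fun h ⟨i, hi⟩
  · rw [List.getElem?_eq_none (by omega), List.getElem?_eq_none (by omega)]

theorem tableauSum_eq_zero_of_lt {n : ℕ} {l : List ℕ} (hl : n < l.length) :
    tableauSum n l = 0 := by
  have : tableaux n l = ∅ := by
    refine Finset.eq_empty_of_forall_notMem fun t ht => ?_
    obtain ⟨h1, h2⟩ := mem_tableaux.1 ht
    have := length_le_of_isTableau (Nat.zero_le n) h1 (by simp)
    rw [← h2, List.length_map] at hl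
    omega
  simp [tableauSum, this]

/-- Partitions with at most `n` parts give tableau sums with pairwise distinct leading exponents, so
in a nontrivial combination the largest of these exponents survives. Longer shapes have no tableaux
on `n` letters. -/
theorem exists_isLead_of_mem_tableauSpan {n : ℕ} {f : OddPlactic n} (hf : f ∈ tableauSpan n)
    (hf0 : f ≠ 0) : ∃ a : Fin n →₀ ℕ, Antitone a ∧ IsLead (toOPol n f) a := by
  have hspan : tableauSpan n ≤ Submodule.span ℤ (Set.range
      fun l : {l : List ℕ // IsPartitionList l ∧ l.length ≤ n} => tableauSum n l) := by
    refine Submodule.span_le.2 ?_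
    rintro _ ⟨l, rfl⟩
    by_cases hl : IsPartitionList l
    · by_cases hn : l.length ≤ n
      · exact Submodule.subset_span ⟨⟨l, hl, hn⟩, rfl⟩
      · rw [tableauSum_eq_zero_of_lt (not_le.1 hn)]; exact zero_mem _
    · rw [tableauSum_eq_zero hl]; exact zero_mem _
  obtain ⟨c, rfl⟩ := Finsupp.mem_span_range_iff_exists_finsupp.1 (hspan hf)
  have hne : c.support.Nonempty := by
    rw [Finset.nonempty_iff_ne_empty]
    intro h
    exact hf0 (by rw [Finsupp.support_eq_empty.1 h]; simp)
  obtain ⟨l, hl, hmax⟩ := c.support.exists_max_image (fun l => toLex (shapeExp n 0 l.1)) hne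
  refine ⟨shapeExp n 0 l.1, fun i j hij => ?_, ?_⟩
  · simpa [shapeExp_apply] using l.2.1.antitone (Fin.le_def.1 hij)
  have hlead (l' : {l : List ℕ // IsPartitionList l ∧ l.length ≤ n}) (h : l' ∈ c.support) :
      IsLead (toOPol n (c l' • tableauSum n l'.1)) (shapeExp n 0 l'.1) := by
    rw [map_zsmul]
    exact (isLead_toOPol_tableauSum l'.2.1 l'.2.2).smul (Finsupp.mem_support_iff.1 h)
  rw [Finsupp.sum, ← Finset.add_sum_erase _ _ hl, map_add, map_sum]
  refine (hlead l hl).add_isBelow (IsBelow.sum fun l' hl' => ?_)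
  obtain ⟨h1, h2⟩ := Finset.mem_erase.1 hl'
  refine (hlead l' h2).isBelow (lt_of_le_of_ne (hmax l' h2) fun h => h1 (Subtype.ext ?_))
  exact shapeExp_injective l'.2.1 l.2.1 l'.2.2 l.2.2 (toLex.injective h)

theorem toOPol_ne_zero {n : ℕ} {f : OddPlactic n} (hf : f ∈ tableauSpan n) (hf0 : f ≠ 0) :
    toOPol n f ≠ 0 := by
  obtain ⟨a, -, ha⟩ := exists_isLead_of_mem_tableauSpan hf hf0
  intro h
  simp [h, IsLead] at ha

/-- The Pieri rule gives one inclusion. For the other, leading exponents in the image of the span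
are partitions, all of which are realised by the elementary algebra; hence both have the same image,
and injectivity on the span lifts this back to the plactic ring. -/
theorem tableauSpan_eq (n : ℕ) :
    tableauSpan n = Subalgebra.toSubmodule (elementaryAlgebra n) := by
  refine le_antisymm (fun f hf => ?_) (elementaryAlgebra_le n)
  have hle : (tableauSpan n).map (toOPol n).toIntAlgHom.toLinearMap ≤
      (Subalgebra.toSubmodule (elementaryAlgebra n)).map (toOPol n).toIntAlgHom.toLinearMap := by
    refine le_of_forall_isLead (Submodule.map_mono (elementaryAlgebra_le n)) ?_
    rintro _ ⟨g, hg, rfl⟩ a ha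
    have hg0 : g ≠ 0 := by
      rintro rfl
      simp [IsLead] at ha
    obtain ⟨b, hb, hb'⟩ := exists_isLead_of_mem_tableauSpan hg hg0
    obtain rfl := hb'.unique ha
    obtain ⟨w, hw, h1, h2⟩ := exists_isLead_of_antitone b hb
    exact ⟨_, ⟨w, hw, rfl⟩, h1, h2⟩
  obtain ⟨g, hg, hgf⟩ := hle ⟨f, hf, rfl⟩
  have h : toOPol n (g - f) = 0 := by rw [map_sub, sub_eq_zero]; exact hgf
  have hmem := sub_mem (elementaryAlgebra_le n hg) hf
  have : g - f = 0 := by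
    by_contra hne
    exact toOPol_ne_zero hmem hne h
  rwa [← sub_eq_zero.1 this]

end OddPlactic

/-! ### The main theorem -/

theorem mainTheorem4 (n : ℕ) (hn : 1 ≤ n) :
    ∃ S : Subalgebra ℤ (OddPlactic n),
      Subalgebra.toSubmodule S
          = Submodule.span ℤ (Set.range fun μ : YoungDiagram => oddPlacticSchur n μ) ∧
      ∃ φ : S ≃ₐ[ℤ] OddSymm n,
        ∀ f : S, (φ f : OPol n) = OddPlactic.toOPol n (f : OddPlactic n) := by
  refine ⟨OddPlactic.elementaryAlgebra n, ?_, ?_⟩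
  · rw [OddPlactic.span_oddPlacticSchur, OddPlactic.tableauSpan_eq]
  · let ψ : OddPlactic.elementaryAlgebra n →ₐ[ℤ] OddSymm n :=
      ((OddPlactic.toOPol n).toIntAlgHom.comp (OddPlactic.elementaryAlgebra n).val).codRestrict
        (OddSymm n) fun f => OddPlactic.toOPol_mem_oddSymm f.2
    have hψ (f) : (ψ f : OPol n) = OddPlactic.toOPol n (f : OddPlactic n) := rfl
    refine ⟨AlgEquiv.ofBijective ψ ⟨?_, ?_⟩, hψ⟩
    · rw [injective_iff_map_eq_zero]
      intro f hf
      by_contra hne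
      refine OddPlactic.toOPol_ne_zero (OddPlactic.elementaryAlgebra_le n f.2)
        (fun h => hne (Subtype.ext h)) ?_
      rw [← hψ, hf]; rfl
    · intro g
      obtain ⟨f, hf, hfg⟩ := OddPlactic.oddSymm_le_map n g.2
      exact ⟨⟨f, hf⟩, Subtype.ext hfg⟩
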